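/- Let $a\ge 2$ be an integer and $t\ge 5$ an odd integer. Let $S_a$ be the star with $a$ edges, and let $S_a(t)$ be an odd-ballooning of $S_a$, that is, a graph obtained from $S_a$ by replacing each edge $e$ by an odd cycle of length at least $t$ containing $e$ (the lengths may differ from edge to edge), where the new vertices of the cycles are all distinct; so $S_a(t)$ consists of $a$ odd cycles of length at least $t$ that share exactly one common vertex and are otherwise disjoint. Let $\mathrm{ex}(n,S_a(t))$ be the maximum number of edges of a graph on $n$ vertices that does not contain $S_a(t)$ as a subgraph, and let $T_2(n)$ be the complete bipartite graph on $n$ vertices whose two classes are as equal in size as possible. Then there is an $N$, depending only on the graph $S_a(t)$, such that for all $n\ge N$ $$\mathrm{ex}(n,S_a(t))=e(T_2(n))+(a-1)^2 ,$$ and a graph on $n$ vertices is extremal (that is, contains no $S_a(t)$ and has $\mathrm{ex}(n,S_a(t))$ edges) if and only if it is isomorphic to a graph obtained from $T_2(n)$ by putting a copy of $K_{a-1,a-1}$ in one class of $T_2(n)$. (For odd $n$ the class may be either the smaller or the larger one.) -/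

import Mathlib

namespace OddBallooning

/-- Adjacency (in one direction) of the graph obtained from `H` by replacing each edge `e` by a cycle
of length `ℓ e`. The vertices are those of `H` together with `ℓ e - 2` new vertices
`⟨e, 0⟩, …, ⟨e, ℓ e - 3⟩` for each edge `e`. If the ends of `e` are `u` and `v`, its cycle consists of
the edge `uv` itself and the path `u, ⟨e, 0⟩, ⟨e, 1⟩, …, ⟨e, ℓ e - 3⟩, v`. Which end of `e` is taken as
`u` is chosen by `Quot.out`; the choice does not matter up to isomorphism. -/
def ballooningRel {V : Type*} (H : SimpleGraph V) (ℓ : H.edgeSet → ℕ) :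
    (V ⊕ (Σ e : H.edgeSet, Fin (ℓ e - 2))) → (V ⊕ (Σ e : H.edgeSet, Fin (ℓ e - 2))) → Prop
  | .inl u, .inl v => H.Adj u v
  | .inl u, .inr x =>
      (u = (Quot.out x.1.1).1 ∧ x.2.val = 0) ∨ (u = (Quot.out x.1.1).2 ∧ x.2.val + 3 = ℓ x.1)
  | .inr x, .inr y => x.1 = y.1 ∧ x.2.val + 1 = y.2.val
  | .inr _, .inl _ => False

/-- The ballooning of `H`: every edge `e` is replaced by a cycle of length `ℓ e` through `e`, the new
vertices of the cycles being all distinct. It is an odd-ballooning `H(t)` when every `ℓ e` is odd and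
at least `t`. -/
def ballooning {V : Type*} (H : SimpleGraph V) (ℓ : H.edgeSet → ℕ) :
    SimpleGraph (V ⊕ (Σ e : H.edgeSet, Fin (ℓ e - 2))) :=
  SimpleGraph.fromRel (ballooningRel H ℓ)

/-- The star `S_a` of order `a + 1`, with centre `0`. -/
abbrev star (a : ℕ) : SimpleGraph (Fin (a + 1)) := SimpleGraph.starGraph 0

/-- `G` is, up to isomorphism, a graph obtained from the Turán graph `T_2(n)` (whose classes are the
residue classes mod `2` in `Fin n`) by putting a copy of `K_{k,k}` in one class, the class `r`. -/
def IsTuranWithBiclique {V : Type*} (n k : ℕ) (G : SimpleGraph V) : Prop :=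
  ∃ (r : ℕ) (φ : (Fin k ⊕ Fin k) ↪ Fin n), (∀ x, (φ x).val % 2 = r) ∧
    Nonempty (G ≃g SimpleGraph.turanGraph n 2 ⊔
      (completeBipartiteGraph (Fin k) (Fin k)).map φ)

end OddBallooning

/-! Lower bound: an odd cycle in the Turán graph plus a biclique uses an edge of the biclique. So
`a` odd cycles sharing only one vertex need `a` distinct vertices on one side of `K_{a-1,a-1}`, one
more than there are.

Upper bound: let `G` be free with at least `n ^ 2 / 4 + (a - 1) ^ 2` edges, and suppose first that
all degrees are at least `n / 2`. A neighbourhood contains no set of large minimum inner degree,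
since disjoint paths in such a set close up to cycles through the centre; hence every neighbourhood
spans only `O(n)` edges. Together with the degree condition this makes one neighbourhood, after
moving boundedly many vertices, a class of a bipartition in which each vertex sees almost all of the
opposite class (`exists_near_complete_bipartition`).

In such a bipartition every edge inside a class is the seed of odd cycles of all lengths from five
on through a vertex `v`, if it contains `v`, or lies in the class of `v`, or lies in the other class
and meets the neighbourhood of `v`. Fewer than `a` disjoint seeds can therefore exist at `v`
(`IsNearBipartition.constraint`). A weighted count over maximal matchings inside the two classes,
where an edge not seen by `v` is paid for by missing cross edges, shows that inner edges minus
missing cross edges is less than `(a - 1) ^ 2` when both classes contain edges. Otherwise it is at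
most `(a - 1) ^ 2`, with equality only for a biclique (`IsNearBipartition.structure_aux`).

The degree assumption is removed by deleting vertices of small degree: each deletion raises the
excess over `n ^ 2 / 4` by at least one, which cannot continue for long
(`card_edgeFinset_le_of_free`). -/

namespace OddBallooning

/-! ### Greedy embedding of cycles through a vertex; sparse neighbourhoods -/

section Embedding

open SimpleGraph Finset
open scoped Classical

variable {V : Type*}

/-- `S` is the vertex set of a path with `m` vertices that avoids `c` and whose two ends are adjacent
to `c`; together with `c` it forms a cycle of length `m + 1`. -/
def IsPetal (G : SimpleGraph V) (c : V) (m : ℕ) (S : Finset V) : Prop :=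
  ∃ l : List V, l.Nodup ∧ l.toFinset = S ∧ l.length = m ∧ c ∉ l ∧ l.IsChain G.Adj ∧
    (∀ x ∈ l.head?, G.Adj c x) ∧ (∀ x ∈ l.getLast?, G.Adj c x)

lemma IsPetal.card_eq {G : SimpleGraph V} {c : V} {m : ℕ} {S : Finset V} (h : IsPetal G c m S) :
    S.card = m := by
  obtain ⟨l, h1, rfl, h3, -⟩ := h
  rw [List.toFinset_card_of_nodup h1, h3]

lemma IsPetal.exists_fun {G : SimpleGraph V} {c : V} {m : ℕ} {S : Finset V}
    (h : IsPetal G c m S) (hm : 1 ≤ m) :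
    ∃ p : ℕ → V, (∀ i < m, p i ∈ S) ∧ (∀ i < m, ∀ j < m, p i = p j → i = j) ∧
      (∀ i < m, p i ≠ c) ∧ (∀ i, i + 1 < m → G.Adj (p i) (p (i + 1))) ∧ G.Adj c (p 0) ∧
      G.Adj c (p (m - 1)) := by
  obtain ⟨l, h1, rfl, h3, h4, h5, h6, h7⟩ := h
  have key : ∀ i (hi : i < m), l.getD i c = l[i]'(by omega) := fun i hi =>
    List.getD_eq_getElem _ _ _
  refine ⟨fun i => l.getD i c, ?_, ?_, ?_, ?_, ?_, ?_⟩
  · intro i hi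
    simp only [key i hi]; simp
  · intro i hi j hj hij
    simp only [key i hi, key j hj] at hij
    exact (List.Nodup.getElem_inj_iff h1).1 hij
  · intro i hi h
    simp only [key i hi] at h
    exact h4 (h ▸ List.getElem_mem _)
  · intro i hi
    simp only [key i (by omega), key (i + 1) hi]
    exact List.isChain_iff_getElem.1 h5 i (by omega)
  · simp only [key 0 (by omega)]
    apply h6
    rw [List.head?_eq_getElem?]; simp
  · simp only [key (m - 1) (by omega)]
    apply h7
    rw [List.getLast?_eq_getElem?]; simp [h3]

lemma mem_star_edge {a : ℕ} (e : (star a).edgeSet) :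
    (Quot.out e.1).1 ≠ (Quot.out e.1).2 ∧ ((Quot.out e.1).1 = 0 ∨ (Quot.out e.1).2 = 0) := by
  have h : s((Quot.out e.1).1, (Quot.out e.1).2) = e.1 := Quot.out_eq e.1
  have h2 := e.2
  rw [← h, mem_edgeSet, starGraph_adj] at h2
  exact h2

/-- The edge of the star that leads to the leaf `w`. -/
def leafEdge {a : ℕ} (w : Fin (a + 1)) (hw : w ≠ 0) : (star a).edgeSet :=
  ⟨s(0, w), by rw [mem_edgeSet, starGraph_adj]; exact ⟨hw.symm, Or.inl rfl⟩⟩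

lemma leafEdge_injective {a : ℕ} {w w' : Fin (a + 1)} {hw : w ≠ 0} {hw' : w' ≠ 0}
    (h : leafEdge w hw = leafEdge w' hw') : w = w' := by
  have h1 : s(0, w) = s(0, w') := congrArg Subtype.val h
  rw [Sym2.eq_iff] at h1
  rcases h1 with h1 | h1
  · exact h1.2
  · exact absurd h1.2 hw

lemma leafEdge_eq_of_out_fst {a : ℕ} (e : (star a).edgeSet) (h : (Quot.out e.1).1 ≠ 0) :
    leafEdge _ h = e := by
  have h0 : (Quot.out e.1).2 = 0 := (mem_star_edge e).2.resolve_left h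
  apply Subtype.ext
  have h1 : s((Quot.out e.1).1, (Quot.out e.1).2) = e.1 := Quot.out_eq e.1
  refine Eq.trans ?_ h1
  change s(0, _) = _
  rw [h0, Sym2.eq_swap]

lemma leafEdge_eq_of_out_snd {a : ℕ} (e : (star a).edgeSet) (h : (Quot.out e.1).2 ≠ 0) :
    leafEdge _ h = e := by
  have h0 : (Quot.out e.1).1 = 0 := (mem_star_edge e).2.resolve_right h
  apply Subtype.ext
  have h1 : s((Quot.out e.1).1, (Quot.out e.1).2) = e.1 := Quot.out_eq e.1
  refine Eq.trans ?_ h1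
  change s(0, _) = _
  rw [h0]

lemma isContained_of_petals {a : ℕ} {ℓ : (star a).edgeSet → ℕ} (hℓ : ∀ e, 3 ≤ ℓ e)
    {G : SimpleGraph V} {c : V} {S : (star a).edgeSet → Finset V}
    (hS : ∀ e, IsPetal G c (ℓ e - 1) (S e)) (hd : ∀ e e', e ≠ e' → Disjoint (S e) (S e')) :
    ballooning (star a) ℓ ⊑ G := by
  choose p hpS hpi hpc hpa hp0 hpl using fun e => (hS e).exists_fun (by have := hℓ e; omega)
  have hinj : ∀ e e' i j, i < ℓ e - 1 → j < ℓ e' - 1 → p e i = p e' j → e = e' ∧ i = j := by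
    intro e e' i j hi hj h
    have he : e = e' := by
      by_contra hne
      exact Finset.disjoint_left.1 (hd e e' hne) (hpS e i hi) (h ▸ hpS e' j hj)
    subst he
    exact ⟨rfl, hpi e i hi j hj h⟩
  -- Position `0` of each petal is the leaf and the last position closes up at the centre. The new
  -- vertices are numbered from the end chosen by `Quot.out`, so the petal is run through backwards
  -- when that end is the centre.
  let idx : (Σ e : (star a).edgeSet, Fin (ℓ e - 2)) → ℕ := fun x =>
    if (Quot.out x.1.1).1 = 0 then ℓ x.1 - 2 - x.2 else x.2 + 1
  have hidx : ∀ x, idx x < ℓ x.1 - 1 ∧ 0 < idx x := by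
    intro x
    have h1 := x.2.2
    have h2 := hℓ x.1
    simp only [idx]
    split_ifs <;> omega
  let f : Fin (a + 1) ⊕ (Σ e : (star a).edgeSet, Fin (ℓ e - 2)) → V := fun z =>
    match z with
    | .inl w => if h : w = 0 then c else p (leafEdge w h) 0
    | .inr x => p x.1 (idx x)
  have f0 : f (.inl 0) = c := by simp [f]
  have fl : ∀ w (h : w ≠ 0), f (.inl w) = p (leafEdge w h) 0 := fun w h => by simp [f, h]
  have fr : ∀ x, f (.inr x) = p x.1 (idx x) := fun x => rfl
  have hpos : ∀ e, 0 < ℓ e - 1 := fun e => by have := hℓ e; omega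
  have hrel : ∀ z z', ballooningRel (star a) ℓ z z' → G.Adj (f z) (f z') := by
    rintro (u | x) (v | y) h
    · obtain ⟨hne, rfl | rfl⟩ := starGraph_adj.1 h
      · rw [f0, fl v hne.symm]; exact hp0 _
      · rw [f0, fl u hne]; exact (hp0 _).symm
    · have h2 := hℓ y.1
      have h3 := y.2.2
      have hl := hpl y.1
      have hm := mem_star_edge y.1
      by_cases ho : (Quot.out y.1.1).1 = 0
      · have hi : idx y = ℓ y.1 - 2 - y.2 := by simp [idx, ho]
        rw [fr, hi]
        rcases h with ⟨rfl, h0⟩ | ⟨rfl, h0⟩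
        · rw [ho, f0, h0]; exact hl
        · have hne : (Quot.out y.1.1).2 ≠ 0 := fun hh => hm.1 (ho.trans hh.symm)
          rw [fl _ hne, leafEdge_eq_of_out_snd]
          have : ℓ y.1 - 2 - y.2 = 0 + 1 := by omega
          rw [this]; exact hpa _ _ (by omega)
      · have hi : idx y = y.2 + 1 := by simp [idx, ho]
        rw [fr, hi]
        rcases h with ⟨rfl, h0⟩ | ⟨rfl, h0⟩
        · rw [fl _ ho, leafEdge_eq_of_out_fst, h0]
          exact hpa _ _ (by omega)
        · rw [hm.2.resolve_left ho, f0]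
          have : (y.2 : ℕ) + 1 = ℓ y.1 - 1 - 1 := by omega
          rw [this]; exact hl
    · exact absurd h id
    · obtain ⟨e, i⟩ := x
      obtain ⟨e', j⟩ := y
      obtain ⟨rfl, hij⟩ : e = e' ∧ i.val + 1 = j.val := h
      have h1 := i.2
      have h2 := j.2
      rw [fr, fr]
      by_cases ho : (Quot.out e.1).1 = 0
      · have hi : idx ⟨e, i⟩ = (ℓ e - 2 - j) + 1 := by simp [idx, ho]; omega
        have hj : idx ⟨e, j⟩ = ℓ e - 2 - j := by simp [idx, ho]
        rw [hi, hj]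
        exact (hpa e _ (by omega)).symm
      · have hi : idx ⟨e, i⟩ = i + 1 := by simp [idx, ho]
        have hj : idx ⟨e, j⟩ = i + 1 + 1 := by simp [idx, ho]; omega
        rw [hi, hj]
        exact hpa e _ (by omega)
  have hfinj : Function.Injective f := by
    rintro (u | x) (v | y) h
    · by_cases hu : u = 0 <;> by_cases hv : v = 0
      · rw [hu, hv]
      · subst hu; rw [f0, fl v hv] at h; exact absurd h.symm (hpc _ _ (hpos _))
      · subst hv; rw [f0, fl u hu] at h; exact absurd h (hpc _ _ (hpos _))
      · rw [fl u hu, fl v hv] at h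
        rw [leafEdge_injective (hinj _ _ _ _ (hpos _) (hpos _) h).1]
    · by_cases hu : u = 0
      · subst hu; rw [f0, fr] at h; exact absurd h.symm (hpc _ _ (hidx _).1)
      · rw [fl u hu, fr] at h
        exact absurd (hinj _ _ _ _ (hpos _) (hidx _).1 h).2 (hidx _).2.ne
    · by_cases hu : v = 0
      · subst hu; rw [f0, fr] at h; exact absurd h (hpc _ _ (hidx _).1)
      · rw [fl v hu, fr] at h
        exact absurd (hinj _ _ _ _ (hidx _).1 (hpos _) h).2 (hidx _).2.ne'
    · rw [fr, fr] at h
      obtain ⟨e, i⟩ := x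
      obtain ⟨e', j⟩ := y
      obtain ⟨h1, h2⟩ := hinj _ _ _ _ (hidx _).1 (hidx _).1 h
      obtain rfl : e = e' := h1
      have h3 := i.2
      have h4 := j.2
      have : i = j := by
        apply Fin.ext
        simp only [idx] at h2
        split_ifs at h2 <;> omega
      rw [this]
  refine ⟨⟨⟨f, ?_⟩, hfinj⟩⟩
  intro z z' h
  rcases (fromRel_adj _ _ _).1 h with ⟨-, h | h⟩
  · exact hrel _ _ h
  · exact (hrel _ _ h).symm

/-- A greedy choice of disjoint sets: the set with index `i` must satisfy `P i`, may use the points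
of `R i`, and can be found outside any set of size at most `B` that is disjoint from `R i`. -/
lemma exists_disjoint_family {ι : Type*} [Fintype ι] (P : ι → Finset V → Prop)
    (R : ι → Finset V) (X₀ : Finset V) (D r B : ℕ)
    (hR : ∀ i j, i ≠ j → Disjoint (R i) (R j)) (hX₀ : ∀ i, Disjoint X₀ (R i))
    (hcard : ∀ i, (R i).card ≤ r)
    (hB : X₀.card + Fintype.card ι * (D + r) ≤ B)
    (h : ∀ i X, X.card ≤ B → Disjoint X (R i) → ∃ S, P i S ∧ S.card ≤ D ∧ Disjoint S X) :
    ∃ S : ι → Finset V, (∀ i, P i (S i)) ∧ (∀ i, Disjoint (S i) X₀) ∧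
      ∀ i j, i ≠ j → Disjoint (S i) (S j) := by
  -- The induction also keeps the chosen sets away from the sets `R j` of all other indices,
  -- including those not yet treated; otherwise the forbidden set could meet `R i` when `i` is
  -- reached.
  have main : ∀ F : Finset ι, ∃ S : ι → Finset V, (∀ i ∈ F, P i (S i) ∧ (S i).card ≤ D) ∧
      (∀ i ∈ F, Disjoint (S i) X₀) ∧ (∀ i ∈ F, ∀ j ∈ F, i ≠ j → Disjoint (S i) (S j)) ∧
      (∀ i ∈ F, ∀ j, i ≠ j → Disjoint (S i) (R j)) := by
    intro F
    induction F using Finset.induction_on with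
    | empty => exact ⟨fun _ => ∅, by simp⟩
    | insert i F hi ih =>
      obtain ⟨S, h1, h2, h3, h4⟩ := ih
      let X : Finset V := X₀ ∪ (F.biUnion S ∪ (univ.erase i).biUnion R)
      have hXc : X.card ≤ B := by
        refine le_trans ?_ hB
        refine (card_union_le _ _).trans (Nat.add_le_add_left ?_ _)
        refine (card_union_le _ _).trans ?_
        rw [mul_add]
        refine Nat.add_le_add ?_ ?_
        · refine (card_biUnion_le_card_mul F S D fun j hj => (h1 j hj).2).trans ?_
          exact Nat.mul_le_mul_right _ (card_le_univ F)
        · refine (card_biUnion_le_card_mul _ R r fun j _ => hcard j).trans ?_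
          exact Nat.mul_le_mul_right _ (card_le_univ _)
      have hXR : Disjoint X (R i) := by
        simp only [X, disjoint_union_left, disjoint_biUnion_left]
        refine ⟨hX₀ i, fun j hj => h4 j hj i fun hh => hi (hh ▸ hj), fun j hj => hR j i ?_⟩
        exact (mem_erase.1 hj).1
      obtain ⟨T, hT1, hT2, hT3⟩ := h i X hXc hXR
      simp only [X, disjoint_union_right, disjoint_biUnion_right] at hT3
      obtain ⟨hT3, hT4, hT5⟩ := hT3
      have hne : ∀ j ∈ F, j ≠ i := fun j hj hh => hi (hh ▸ hj)
      refine ⟨Function.update S i T, ?_, ?_, ?_, ?_⟩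
      · intro j hj
        rcases mem_insert.1 hj with rfl | hj
        · simpa using ⟨hT1, hT2⟩
        · rw [Function.update_of_ne (hne j hj)]; exact h1 j hj
      · intro j hj
        rcases mem_insert.1 hj with rfl | hj
        · simpa using hT3
        · rw [Function.update_of_ne (hne j hj)]; exact h2 j hj
      · intro j hj j' hj' hjj
        rcases mem_insert.1 hj with rfl | hm <;> rcases mem_insert.1 hj' with rfl | hm'
        · exact absurd rfl hjj
        · rw [Function.update_self, Function.update_of_ne (hne j' hm')]; exact hT4 _ hm'
        · rw [Function.update_self, Function.update_of_ne (hne j hm)]; exact (hT4 _ hm).symm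
        · rw [Function.update_of_ne (hne j hm), Function.update_of_ne (hne j' hm')]
          exact h3 j hm j' hm' hjj
      · intro j hj j' hjj
        rcases mem_insert.1 hj with rfl | hj
        · rw [Function.update_self]; exact hT5 j' (by simp [hjj.symm])
        · rw [Function.update_of_ne (hne j hj)]; exact h4 j hj j' hjj
  obtain ⟨S, h1, h2, h3, -⟩ := main univ
  exact ⟨S, fun i => (h1 i (mem_univ i)).1, fun i => h2 i (mem_univ i),
    fun i j => h3 i (mem_univ i) j (mem_univ j)⟩

lemma card_edgeSet_star (a : ℕ) : Fintype.card (star a).edgeSet = a := by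
  have : Function.Bijective (fun w : {w : Fin (a + 1) // w ≠ 0} => leafEdge w.1 w.2) := by
    constructor
    · intro w w' h
      exact Subtype.ext (leafEdge_injective h)
    · intro e
      rcases (mem_star_edge e).2 with h | h
      · have : (Quot.out e.1).2 ≠ 0 := fun hh => (mem_star_edge e).1 (h.trans hh.symm)
        exact ⟨⟨_, this⟩, leafEdge_eq_of_out_snd e this⟩
      · have : (Quot.out e.1).1 ≠ 0 := fun hh => (mem_star_edge e).1 (hh.trans h.symm)
        exact ⟨⟨_, this⟩, leafEdge_eq_of_out_fst e this⟩
  rw [← Fintype.card_congr (Equiv.ofBijective _ this)]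
  simp [Fintype.card_subtype_compl]

/-- A set of vertices of degree at least `L` inside the set contains long paths. -/
lemma exists_path_in_set [Fintype V] {G : SimpleGraph V} {S : Finset V} {L : ℕ}
    (hL : ∀ w ∈ S, L ≤ (G.neighborFinset w ∩ S).card) :
    ∀ (m : ℕ) (x : V) (X : Finset V), x ∈ S → x ∉ X → X.card + m ≤ L →
      ∃ l : List V, l.length = m ∧ (x :: l).Nodup ∧ (x :: l).IsChain G.Adj ∧ (∀ y ∈ x :: l, y ∈ S) ∧
        ∀ y ∈ x :: l, y ∉ X := by
  intro m
  induction m with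
  | zero => intro x X hx hX _; exact ⟨[], by simp [hx, hX]⟩
  | succ m ih =>
    intro x X hx hX hc
    have : ∃ y ∈ G.neighborFinset x ∩ S, y ∉ X := by
      by_contra! hcon
      have := card_le_card (show G.neighborFinset x ∩ S ⊆ X from hcon)
      have := hL x hx
      omega
    obtain ⟨y, hy, hyX⟩ := this
    rw [mem_inter, mem_neighborFinset] at hy
    have hyx : y ∉ insert x X := by
      rw [mem_insert, not_or]; exact ⟨hy.1.ne', hyX⟩
    obtain ⟨l, h1, h2, h3, h4, h5⟩ := ih y (insert x X) hy.2 hyx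
      (by have := card_insert_le x X; omega)
    refine ⟨y :: l, by simp [h1], ?_, ?_, ?_, ?_⟩
    · rw [List.nodup_cons]
      exact ⟨fun hh => h5 x hh (mem_insert_self _ _), h2⟩
    · rw [List.isChain_cons_cons]; exact ⟨hy.1, h3⟩
    · intro z hz
      rcases List.mem_cons.1 hz with rfl | hz
      · exact hx
      · exact h4 z hz
    · intro z hz
      rcases List.mem_cons.1 hz with rfl | hz
      · exact hX
      · exact fun hh => h5 z hz (mem_insert_of_mem hh)

/-- All of `S` is adjacent to `c`, so any path inside `S` closes up to a cycle through `c`, whatever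
its parity. The degree bound leaves room for `a * D` used vertices and one more path. -/
lemma isContained_of_dense_neighborhood [Fintype V] {a : ℕ} {ℓ : (star a).edgeSet → ℕ}
    (hℓ : ∀ e, 3 ≤ ℓ e) {D : ℕ} (hD : ∀ e, ℓ e ≤ D)
    {G : SimpleGraph V} {c : V} {S : Finset V} (hS : S ⊆ G.neighborFinset c) (hne : S.Nonempty)
    (hL : ∀ w ∈ S, a * D + D ≤ (G.neighborFinset w ∩ S).card) :
    ballooning (star a) ℓ ⊑ G := by
  obtain ⟨S', h1, -, h3⟩ := exists_disjoint_family
    (fun e T => IsPetal G c (ℓ e - 1) T) (fun _ => (∅ : Finset V)) ∅ D 0 (a * D)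
    (by simp) (by simp) (by simp) (by
      have := card_edgeSet_star a
      simp only [card_empty, zero_add, add_zero]
      rw [this]) (by
      intro e X hX _
      have h3 := hℓ e
      have hDe := hD e
      obtain ⟨x, hx, hxX⟩ : ∃ x ∈ S, x ∉ X := by
        by_contra! hcon
        obtain ⟨w, hw⟩ := hne
        have h1 := hL w hw
        have h2 := card_le_card (inter_subset_right (s₁ := G.neighborFinset w) (s₂ := S))
        have := card_le_card (show S ⊆ X from hcon)
        omega
      obtain ⟨l, h1, h2, h3, h4, h5⟩ := exists_path_in_set hL (ℓ e - 2) x X hx hxX (by omega)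
      have hadj : ∀ y ∈ x :: l, G.Adj c y := fun y hy => by
        have := hS (h4 y hy)
        rwa [mem_neighborFinset] at this
      have hp : IsPetal G c (ℓ e - 1) (x :: l).toFinset :=
        ⟨x :: l, h2, rfl, by simp [h1]; omega, fun hc => (hadj c hc).ne rfl, h3,
          fun y hy => hadj y (List.mem_of_mem_head? hy),
          fun y hy => hadj y (List.mem_of_mem_getLast? hy)⟩
      refine ⟨_, hp, by rw [hp.card_eq]; omega, ?_⟩
      rw [Finset.disjoint_left]
      intro y hy
      exact h5 y (List.mem_toFinset.1 hy))
  exact isContained_of_petals hℓ h1 h3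

/-- If every nonempty subset of `S` has a vertex with fewer than `L` neighbours in the subset, then
`S` spans few edges. -/
lemma sum_inner_degree_le [Fintype V] {G : SimpleGraph V} {L : ℕ} (S : Finset V)
    (h : ∀ T ⊆ S, T.Nonempty → ∃ w ∈ T, (G.neighborFinset w ∩ T).card < L) :
    ∑ w ∈ S, (G.neighborFinset w ∩ S).card ≤ 2 * L * S.card := by
  induction S using Finset.strongInduction with
  | H S ih =>
    rcases S.eq_empty_or_nonempty with rfl | hne
    · simp
    obtain ⟨w, hw, hwL⟩ := h S Subset.rfl hne
    have ih' := ih (S.erase w) (erase_ssubset hw) fun T hT => h T (hT.trans (erase_subset _ _))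
    rw [← add_sum_erase _ _ hw]
    have h1 : ∀ x ∈ S.erase w, (G.neighborFinset x ∩ S).card ≤
        (G.neighborFinset x ∩ S.erase w).card + if G.Adj w x then 1 else 0 := by
      intro x hx
      have : G.neighborFinset x ∩ S ⊆
          (G.neighborFinset x ∩ S.erase w) ∪ if G.Adj w x then {w} else ∅ := by
        intro y hy
        simp only [mem_inter, mem_neighborFinset, mem_union, mem_erase] at hy ⊢
        by_cases hyw : y = w
        · subst hyw; right; simp [hy.1.symm]
        · exact Or.inl ⟨hy.1, hyw, hy.2⟩
      refine (card_le_card this).trans ((card_union_le _ _).trans (Nat.add_le_add_left ?_ _))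
      split_ifs <;> simp
    have h2 := sum_le_sum h1
    rw [sum_add_distrib] at h2
    have h3 : ∑ x ∈ S.erase w, (if G.Adj w x then 1 else 0) ≤ (G.neighborFinset w ∩ S).card := by
      rw [← card_filter]
      apply card_le_card
      intro x hx
      simp only [mem_filter, mem_erase, mem_inter, mem_neighborFinset] at hx ⊢
      exact ⟨hx.2, hx.1.2⟩
    have h4 : (S.erase w).card + 1 = S.card := card_erase_add_one hw
    rw [← h4]
    have : 2 * L * ((S.erase w).card + 1) = 2 * L * (S.erase w).card + 2 * L := by ring
    omega

lemma sum_inner_degree_neighborFinset_le [Fintype V] {a : ℕ} {ℓ : (star a).edgeSet → ℕ}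
    (hℓ : ∀ e, 3 ≤ ℓ e) {D : ℕ} (hD : ∀ e, ℓ e ≤ D)
    {G : SimpleGraph V} (hG : (ballooning (star a) ℓ).Free G) (c : V) :
    ∑ w ∈ G.neighborFinset c, (G.neighborFinset w ∩ G.neighborFinset c).card ≤
      2 * (a * D + D) * Fintype.card V := by
  refine (sum_inner_degree_le (L := a * D + D) _ ?_).trans
    (Nat.mul_le_mul_left _ (card_le_univ _))
  intro T hT hne
  by_contra! hcon
  exact hG (isContained_of_dense_neighborhood hℓ hD hT hne hcon)

end Embedding

end OddBallooning

namespace OddBallooning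

/-! ### A near-complete bipartition from one sparse neighbourhood -/

section Stability

open SimpleGraph Finset
open scoped Classical

variable {V : Type*} [Fintype V]

lemma sum_card_sdiff_neighborFinset_comm (G : SimpleGraph V) (S T : Finset V) :
    ∑ x ∈ S, (T \ G.neighborFinset x).card = ∑ y ∈ T, (S \ G.neighborFinset y).card := by
  have := sum_card_bipartiteAbove_eq_sum_card_bipartiteBelow (fun x y => ¬ G.Adj x y)
    (s := S) (t := T)
  convert this using 2 with x _ y _ <;> congr 1 <;> ext z <;>
    simp [bipartiteAbove, bipartiteBelow, G.adj_comm]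

/-- A pair in `P × Q` is either an edge inside `N` or a missing cross pair. -/
lemma card_mul_card_le (G : SimpleGraph V) (A P Q N : Finset V) (hP : P ⊆ N) (hPA : P ⊆ A)
    (hQ : Q ⊆ N) (hQA : Q ⊆ Aᶜ) :
    P.card * Q.card ≤ ∑ x ∈ N, (G.neighborFinset x ∩ N).card +
      ∑ x ∈ A, (Aᶜ \ G.neighborFinset x).card := by
  have h1 : P.card * Q.card = ∑ x ∈ P, (Q ∩ G.neighborFinset x).card +
      ∑ x ∈ P, (Q \ G.neighborFinset x).card := by
    rw [← sum_add_distrib, ← smul_eq_mul, ← sum_const]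
    exact sum_congr rfl fun x _ => (card_inter_add_card_sdiff _ _).symm
  rw [h1]
  refine Nat.add_le_add ?_ ?_
  · refine (sum_le_sum fun x _ => card_le_card ?_).trans (sum_le_sum_of_subset hP)
    rw [inter_comm]
    exact inter_subset_inter_left hQ
  · exact (sum_le_sum fun x _ => card_le_card (sdiff_subset_sdiff hQA Subset.rfl)).trans
      (sum_le_sum_of_subset hPA)

/-- The neighbourhood `A₀` of any vertex has at least `n / 2` vertices and few inner edges, so its
vertices must send almost all their edges to `A₀ᶜ`. Only boundedly many vertices are atypical, and
reassigning each vertex by its degree into `A₀` repairs these. -/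
lemma exists_near_complete_bipartition (G : SimpleGraph V) {L n : ℕ} (hn : Fintype.card V = n)
    (hmin : ∀ v, n / 2 ≤ (G.neighborFinset v).card)
    (hL : ∀ v, ∑ w ∈ G.neighborFinset v, (G.neighborFinset w ∩ G.neighborFinset v).card ≤
      2 * L * n)
    (hlarge : 4096 * (2 * L + 1) < n) :
    ∃ A : Finset V, (∀ v ∈ A, 16 * (Aᶜ \ G.neighborFinset v).card ≤ n) ∧
      (∀ v ∉ A, 16 * (A \ G.neighborFinset v).card ≤ n) ∧ n ≤ 4 * A.card ∧ n ≤ 4 * (Aᶜ).card := by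
  obtain ⟨v₀⟩ : Nonempty V := Fintype.card_pos_iff.1 (by omega)
  obtain ⟨A₀, hA₀⟩ : ∃ A₀, A₀ = G.neighborFinset v₀ := ⟨_, rfl⟩
  have hcA : A₀.card + (A₀ᶜ).card = n := by rw [card_add_card_compl, hn]
  have hA₀c : n / 2 ≤ A₀.card := hA₀ ▸ hmin v₀
  have hdeg : ∀ w, (G.neighborFinset w ∩ A₀).card + (G.neighborFinset w ∩ A₀ᶜ).card =
      (G.neighborFinset w).card := fun w => by
    rw [← card_inter_add_card_sdiff (G.neighborFinset w) A₀, sdiff_eq_inter_compl]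
  have hmA : ∀ w, (A₀ \ G.neighborFinset w).card + (G.neighborFinset w ∩ A₀).card = A₀.card :=
    fun w => by rw [inter_comm, card_sdiff_add_card_inter]
  have hmB : ∀ w, (A₀ᶜ \ G.neighborFinset w).card + (G.neighborFinset w ∩ A₀ᶜ).card =
      (A₀ᶜ).card := fun w => by rw [inter_comm, card_sdiff_add_card_inter]
  have hin : ∑ w ∈ A₀, (G.neighborFinset w ∩ A₀).card ≤ 2 * L * n := by rw [hA₀]; exact hL v₀
  -- A vertex of `A₀` has degree at least `n / 2` and `A₀ᶜ` has at most `n / 2 + 1` vertices, so it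
  -- misses at most one more vertex of `A₀ᶜ` than it has neighbours in `A₀`.
  have hmiss : ∑ x ∈ A₀, (A₀ᶜ \ G.neighborFinset x).card ≤ (2 * L + 1) * n := by
    have h1 : ∀ x ∈ A₀, (A₀ᶜ \ G.neighborFinset x).card ≤ 1 + (G.neighborFinset x ∩ A₀).card := by
      intro x _
      have := hdeg x
      have := hmB x
      have := hmin x
      omega
    refine (sum_le_sum h1).trans ?_
    rw [sum_add_distrib, sum_const, smul_eq_mul, mul_one]
    have : A₀.card ≤ n := by omega
    linarith
  -- With `n / 32` neighbours on both sides, `w` would have quadratically many pairs across its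
  -- neighbourhood, against the linear bound on edges inside it and on missing pairs.
  have hsplit : ∀ w, ¬ 32 * (G.neighborFinset w ∩ A₀).card < n →
      32 * (G.neighborFinset w ∩ A₀ᶜ).card < n := by
    intro w h1
    by_contra h2
    push Not at h1 h2
    have h3 := card_mul_card_le G A₀ (G.neighborFinset w ∩ A₀) (G.neighborFinset w ∩ A₀ᶜ)
      (G.neighborFinset w) inter_subset_left inter_subset_right inter_subset_left
      inter_subset_right
    have h4 : (G.neighborFinset w ∩ A₀).card * (G.neighborFinset w ∩ A₀ᶜ).card ≤
        2 * L * n + (2 * L + 1) * n := h3.trans (Nat.add_le_add (hL w) hmiss)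
    have h5 := Nat.mul_le_mul h1 h2
    have h6 : n * (4096 * (2 * L + 1)) < n * n := Nat.mul_lt_mul_of_pos_left hlarge (by omega)
    nlinarith
  obtain ⟨A, hA⟩ : ∃ A : Finset V,
    A = univ.filter fun w => 32 * (G.neighborFinset w ∩ A₀).card < n := ⟨_, rfl⟩
  have hmem : ∀ w, w ∈ A ↔ 32 * (G.neighborFinset w ∩ A₀).card < n := fun w => by simp [hA]
  have hd1 : (A₀ \ A).card ≤ 64 * L := by
    have h1 : ∑ w ∈ A₀ \ A, n ≤ ∑ w ∈ A₀ \ A, 32 * (G.neighborFinset w ∩ A₀).card := by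
      refine sum_le_sum fun w hw => ?_
      have := (mem_sdiff.1 hw).2
      rw [hmem] at this
      omega
    have h2 : ∑ w ∈ A₀ \ A, 32 * (G.neighborFinset w ∩ A₀).card ≤
        ∑ w ∈ A₀, 32 * (G.neighborFinset w ∩ A₀).card := sum_le_sum_of_subset sdiff_subset
    rw [sum_const, smul_eq_mul] at h1
    have h2 := h1.trans h2
    rw [← mul_sum] at h2
    have h3 : (A₀ \ A).card * n ≤ 64 * L * n := by linarith
    exact Nat.le_of_mul_le_mul_right h3 (by omega)
  -- Each such vertex misses at least `n / 4` of the vertices of `A₀`, and the total number of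
  -- missing pairs is linear.
  have hd2 : (A \ A₀).card ≤ 4 * (2 * L + 1) := by
    have h1 : ∑ w ∈ A \ A₀, n ≤ ∑ w ∈ A \ A₀, 4 * (A₀ \ G.neighborFinset w).card := by
      refine sum_le_sum fun w hw => ?_
      have := (mem_sdiff.1 hw).1
      rw [hmem] at this
      have := hmA w
      omega
    have h2 : ∑ w ∈ A \ A₀, 4 * (A₀ \ G.neighborFinset w).card ≤
        ∑ w ∈ A₀ᶜ, 4 * (A₀ \ G.neighborFinset w).card :=
      sum_le_sum_of_subset fun x hx => mem_compl.2 (mem_sdiff.1 hx).2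
    rw [sum_const, smul_eq_mul] at h1
    have h2 := h1.trans h2
    rw [← mul_sum, ← sum_card_sdiff_neighborFinset_comm] at h2
    have h3 : (A \ A₀).card * n ≤ 4 * (2 * L + 1) * n := by linarith
    exact Nat.le_of_mul_le_mul_right h3 (by omega)
  -- A vertex of `A₀` of at most average inner degree has nearly `n / 2` neighbours in `A₀ᶜ`, so
  -- `A₀ᶜ` cannot be much smaller than that.
  have hA₀le : A₀.card ≤ n / 2 + 1 + 6 * L := by
    obtain ⟨u, -, hu⟩ : ∃ u ∈ A₀, (G.neighborFinset u ∩ A₀).card ≤ 6 * L := by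
      by_contra! hcon
      have h1 : ∑ w ∈ A₀, (6 * L + 1) ≤ ∑ w ∈ A₀, (G.neighborFinset w ∩ A₀).card :=
        sum_le_sum fun w hw => hcon w hw
      rw [sum_const, smul_eq_mul] at h1
      have h2 : n ≤ 3 * A₀.card := by omega
      have h3 : A₀.card * (6 * L + 1) ≤ 2 * L * n := h1.trans hin
      have h4 : 2 * L * n ≤ 2 * L * (3 * A₀.card) := Nat.mul_le_mul_left _ h2
      have h5 : 2 * L * (3 * A₀.card) = A₀.card * (6 * L) := by ring
      have h6 : A₀.card * (6 * L + 1) = A₀.card * (6 * L) + A₀.card := by ring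
      omega
    have := hdeg u
    have := hmB u
    have := hmin u
    omega
  have hc1 : A₀.card ≤ A.card + (A₀ \ A).card := by
    have h1 : A₀ ⊆ A ∪ (A₀ \ A) := by
      intro x hx
      by_cases hxA : x ∈ A
      · exact mem_union_left _ hxA
      · exact mem_union_right _ (mem_sdiff.2 ⟨hx, hxA⟩)
    exact (card_le_card h1).trans (card_union_le _ _)
  have hc2 : (A₀ᶜ).card ≤ (Aᶜ).card + (A \ A₀).card := by
    have h1 : A₀ᶜ ⊆ Aᶜ ∪ (A \ A₀) := by
      intro x hx
      by_cases hxA : x ∈ A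
      · exact mem_union_right _ (mem_sdiff.2 ⟨hxA, mem_compl.1 hx⟩)
      · exact mem_union_left _ (mem_compl.2 hxA)
    exact (card_le_card h1).trans (card_union_le _ _)
  refine ⟨A, ?_, ?_, by omega, by omega⟩
  · intro v hv
    rw [hmem] at hv
    have h1 : Aᶜ \ G.neighborFinset v ⊆ (A₀ᶜ \ G.neighborFinset v) ∪ (A₀ \ A) := by
      intro x hx
      simp only [mem_sdiff, mem_compl, mem_union] at hx ⊢
      tauto
    have h2 := (card_le_card h1).trans (card_union_le _ _)
    have := hdeg v
    have := hmB v
    have := hmin v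
    omega
  · intro v hv
    have hv' := hsplit v (by rwa [hmem] at hv)
    have h1 : A \ G.neighborFinset v ⊆ (A₀ \ G.neighborFinset v) ∪ (A \ A₀) := by
      intro x hx
      simp only [mem_sdiff, mem_union] at hx ⊢
      tauto
    have h2 := (card_le_card h1).trans (card_union_le _ _)
    have := hdeg v
    have := hmA v
    have := hmin v
    omega

end Stability

end OddBallooning

namespace OddBallooning

/-! ### Odd cycles seeded by edges inside a class -/

section Constraint

open SimpleGraph Finset
open scoped Classical

variable {V : Type*} [Fintype V]

/-- The pair `(A, Aᶜ)` is close to a complete bipartite graph: both classes are large and each vertex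
is adjacent to almost all vertices of the other class. -/
structure IsNearBipartition (G : SimpleGraph V) (n : ℕ) (A : Finset V) : Prop where
  left : ∀ v ∈ A, 16 * (Aᶜ \ G.neighborFinset v).card ≤ n
  right : ∀ v ∉ A, 16 * (A \ G.neighborFinset v).card ≤ n
  card_left : n ≤ 4 * A.card
  card_right : n ≤ 4 * (Aᶜ).card

variable {G : SimpleGraph V} {n : ℕ} {A : Finset V}

lemma IsNearBipartition.compl (h : IsNearBipartition G n A) : IsNearBipartition G n Aᶜ where
  left v hv := by rw [compl_compl]; exact h.right v (mem_compl.1 hv)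
  right v hv := h.left v (by simpa using hv)
  card_left := h.card_right
  card_right := by rw [compl_compl]; exact h.card_left

/-- The opposite class has at least `n / 4` vertices; `x` and `y` miss at most `n / 16` each, and
`X` cannot exhaust the remaining `n / 8`. -/
lemma IsNearBipartition.exists_common_neighbor (h : IsNearBipartition G n A) {x y : V}
    (hx : x ∈ A) (hy : y ∈ A) {X : Finset V} (hX : 8 * X.card < n) :
    ∃ z ∉ A, G.Adj x z ∧ G.Adj y z ∧ z ∉ X := by
  by_contra! hcon
  have h1 : Aᶜ ⊆ (Aᶜ \ G.neighborFinset x) ∪ ((Aᶜ \ G.neighborFinset y) ∪ X) := by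
    intro z hz
    simp only [mem_union, mem_sdiff, mem_neighborFinset]
    have := hcon z (mem_compl.1 hz)
    tauto
  have h2 := card_le_card h1
  have h3 := card_union_le (Aᶜ \ G.neighborFinset x) ((Aᶜ \ G.neighborFinset y) ∪ X)
  have h4 := card_union_le (Aᶜ \ G.neighborFinset y) X
  have := h.left x hx
  have := h.left y hy
  have := h.card_right
  omega

lemma IsNearBipartition.exists_neighbor (h : IsNearBipartition G n A) (x : V) {X : Finset V}
    (hX : 8 * X.card < n) : ∃ z, (z ∈ A ↔ x ∉ A) ∧ G.Adj x z ∧ z ∉ X := by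
  by_cases hx : x ∈ A
  · obtain ⟨z, h1, h2, -, h3⟩ := h.exists_common_neighbor hx hx hX
    exact ⟨z, by tauto, h2, h3⟩
  · obtain ⟨z, h1, h2, -, h3⟩ := h.compl.exists_common_neighbor (mem_compl.2 hx) (mem_compl.2 hx) hX
    rw [mem_compl, not_not] at h1
    exact ⟨z, by tauto, h2, h3⟩

/-- The path alternates between the classes. The parity condition puts the last vertex in `Aᶜ`,
where it is chosen as a common neighbour of its predecessor and `v`. -/
lemma IsNearBipartition.exists_tail (h : IsNearBipartition G n A) {v : V} (hv : v ∈ A) :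
    ∀ (j : ℕ) (y : V) (X : Finset V), (y ∈ A ↔ Even j) → 8 * (X.card + j) < n →
      ∃ l : List V, l.length = j + 1 ∧ l.Nodup ∧ (∀ z ∈ l, z ∉ X) ∧ (y :: l).IsChain G.Adj ∧
        ∀ z ∈ l.getLast?, G.Adj v z := by
  intro j
  induction j with
  | zero =>
    intro y X hy hX
    obtain ⟨z, -, h2, h3, h4⟩ := h.exists_common_neighbor (x := y) (y := v) (by simpa using hy) hv
      (X := X) (by omega)
    exact ⟨[z], by simp [h2, h3, h4]⟩
  | succ j ih =>
    intro y X hy hX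
    obtain ⟨z, h1, h2, h3⟩ := h.exists_neighbor y (X := X) (by omega)
    obtain ⟨l, k1, k2, k3, k4, k5⟩ := ih z (insert z X)
      (by rw [h1, hy, Nat.even_add_one, not_not])
      (by have := card_insert_le z X; omega)
    refine ⟨z :: l, by simp [k1], ?_, ?_, ?_, ?_⟩
    · rw [List.nodup_cons]
      exact ⟨fun hh => k3 z hh (mem_insert_self _ _), k2⟩
    · intro w hw
      rcases List.mem_cons.1 hw with rfl | hw
      · exact h3
      · exact fun hh => k3 w hw (mem_insert_of_mem hh)
    · rw [List.isChain_cons_cons]; exact ⟨h2, k4⟩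
    · have hne : l ≠ [] := by rintro rfl; simp at k1
      rwa [List.getLast?_cons_of_ne_nil hne]

/-- Outside any small set disjoint from `R` there is a cycle of any given odd length, at least five,
through `v`. -/
def IsSeed (G : SimpleGraph V) (n : ℕ) (v : V) (R : Finset V) : Prop :=
  ∀ L, 5 ≤ L → Odd L → ∀ X : Finset V, 8 * (X.card + L + 5) < n → Disjoint X R →
    ∃ S, IsPetal G v (L - 1) S ∧ Disjoint S X

/-- The cycle is `v, x` and an alternating tail back to `v`; `vx` is its only edge inside a class.
-/
lemma IsNearBipartition.isSeed_singleton (h : IsNearBipartition G n A) {v x : V} (hv : v ∈ A)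
    (hx : x ∈ A) (hvx : G.Adj v x) : IsSeed G n v {x} := by
  intro L hL hodd X hX hd
  rw [disjoint_singleton_right] at hd
  obtain ⟨l, h1, h2, h3, h4, h5⟩ := h.exists_tail hv (L - 3) x (insert x (insert v X))
    (by simp only [hx, true_iff]; obtain ⟨q, rfl⟩ := hodd; exact ⟨q - 1, by omega⟩)
    (by have := card_insert_le x (insert v X); have := card_insert_le v X; omega)
  have hne : l ≠ [] := by rintro rfl; simp at h1
  simp only [mem_insert, not_or] at h3
  refine ⟨_, ⟨x :: l, ?_, rfl, ?_, ?_, h4, ?_, ?_⟩, ?_⟩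
  · rw [List.nodup_cons]; exact ⟨fun hh => (h3 x hh).1 rfl, h2⟩
  · simp only [List.length_cons, h1]; omega
  · rw [List.mem_cons, not_or]; exact ⟨hvx.ne, fun hh => (h3 v hh).2.1 rfl⟩
  · simpa using hvx
  · rwa [List.getLast?_cons_of_ne_nil hne]
  · rw [Finset.disjoint_left]
    intro z hz
    rcases List.mem_cons.1 (List.mem_toFinset.1 hz) with rfl | hz
    · exact hd
    · exact (h3 z hz).2.2

/-- The cycle is `v, w, x, y` and a tail, with `w` a common neighbour of `v` and `x`. The tail has
at least one vertex, and this is where length five is needed: no triangle through `v` contains an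
edge of the same class not seen by `v`. -/
lemma IsNearBipartition.isSeed_pair (h : IsNearBipartition G n A) {v x y : V} (hv : v ∈ A)
    (hx : x ∈ A) (hy : y ∈ A) (hxy : G.Adj x y) (hvx : v ≠ x) (hvy : v ≠ y) :
    IsSeed G n v {x, y} := by
  intro L hL hodd X hX hd
  simp only [disjoint_insert_right, disjoint_singleton_right] at hd
  obtain ⟨w, w1, w2, w3, w4⟩ := h.exists_common_neighbor hv hx (X := X) (by omega)
  have hwv := w2.ne'
  have hwx := w3.ne'
  have hwy : w ≠ y := fun hh => w1 (hh ▸ hy)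
  obtain ⟨l, h1, h2, h3, h4, h5⟩ := h.exists_tail hv (L - 5) y
    (insert w (insert x (insert y (insert v X))))
    (by simp only [hy, true_iff]; obtain ⟨q, rfl⟩ := hodd; exact ⟨q - 2, by omega⟩)
    (by
      have := card_insert_le w (insert x (insert y (insert v X)))
      have := card_insert_le x (insert y (insert v X))
      have := card_insert_le y (insert v X); have := card_insert_le v X; omega)
  have hne : l ≠ [] := by rintro rfl; simp at h1
  simp only [mem_insert, not_or] at h3
  refine ⟨_, ⟨w :: x :: y :: l, ?_, rfl, ?_, ?_, ?_, ?_, ?_⟩, ?_⟩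
  · simp only [List.nodup_cons, List.mem_cons, not_or]
    exact ⟨⟨hwx, hwy, fun hh => (h3 w hh).1 rfl⟩, ⟨hxy.ne, fun hh => (h3 x hh).2.1 rfl⟩,
      fun hh => (h3 y hh).2.2.1 rfl, h2⟩
  · simp only [List.length_cons, h1]; omega
  · simp only [List.mem_cons, not_or]
    exact ⟨hwv.symm, hvx, hvy, fun hh => (h3 v hh).2.2.2.1 rfl⟩
  · simp only [List.isChain_cons_cons]; exact ⟨w3.symm, hxy, h4⟩
  · simpa using w2
  · rwa [List.getLast?_cons_cons, List.getLast?_cons_cons, List.getLast?_cons_of_ne_nil hne]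
  · rw [Finset.disjoint_left]
    intro z hz
    rw [List.mem_toFinset] at hz
    simp only [List.mem_cons] at hz
    rcases hz with rfl | rfl | rfl | hz
    · exact w4
    · exact hd.1
    · exact hd.2
    · exact (h3 z hz).2.2.2.2

/-- The cycle is `v, x, y` and a tail, which now starts in the opposite class and hence has the
other parity. -/
lemma IsNearBipartition.isSeed_pair_of_adj (h : IsNearBipartition G n A) {v x y : V} (hv : v ∈ A)
    (hy : y ∉ A) (hxy : G.Adj x y) (hvx : G.Adj v x) :
    IsSeed G n v {x, y} := by
  intro L hL hodd X hX hd
  simp only [disjoint_insert_right, disjoint_singleton_right] at hd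
  have hvy : v ≠ y := fun hh => hy (hh ▸ hv)
  obtain ⟨l, h1, h2, h3, h4, h5⟩ := h.exists_tail hv (L - 4) y
    (insert x (insert y (insert v X)))
    (by
      simp only [hy, false_iff, Nat.not_even_iff_odd]
      obtain ⟨q, rfl⟩ := hodd; exact ⟨q - 2, by omega⟩)
    (by
      have := card_insert_le x (insert y (insert v X))
      have := card_insert_le y (insert v X); have := card_insert_le v X; omega)
  have hne : l ≠ [] := by rintro rfl; simp at h1
  simp only [mem_insert, not_or] at h3
  refine ⟨_, ⟨x :: y :: l, ?_, rfl, ?_, ?_, ?_, ?_, ?_⟩, ?_⟩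
  · simp only [List.nodup_cons, List.mem_cons, not_or]
    exact ⟨⟨hxy.ne, fun hh => (h3 x hh).1 rfl⟩, fun hh => (h3 y hh).2.1 rfl, h2⟩
  · simp only [List.length_cons, h1]; omega
  · simp only [List.mem_cons, not_or]
    exact ⟨hvx.ne, hvy, fun hh => (h3 v hh).2.2.1 rfl⟩
  · simp only [List.isChain_cons_cons]; exact ⟨hxy, h4⟩
  · simpa using hvx
  · rwa [List.getLast?_cons_cons, List.getLast?_cons_of_ne_nil hne]
  · rw [Finset.disjoint_left]
    intro z hz
    rw [List.mem_toFinset] at hz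
    simp only [List.mem_cons] at hz
    rcases hz with rfl | rfl | hz
    · exact hd.1
    · exact hd.2
    · exact (h3 z hz).2.2.2

lemma isContained_of_seeds {V : Type*} {G : SimpleGraph V} {n a : ℕ}
    {ℓ : (star a).edgeSet → ℕ} (hℓ : ∀ e, 5 ≤ ℓ e ∧ Odd (ℓ e)) {D : ℕ} (hD : ∀ e, ℓ e ≤ D) (hn : 8 * (a * (D + 2) + D + 5) < n) {v : V}
    {T : Type*} [Fintype T] (R : T → Finset V) (hR : ∀ i j, i ≠ j → Disjoint (R i) (R j))
    (hc : ∀ i, (R i).card ≤ 2) (hs : ∀ i, IsSeed G n v (R i)) (hT : a ≤ Fintype.card T) :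
    ballooning (star a) ℓ ⊑ G := by
  have hca := card_edgeSet_star a
  obtain ⟨g⟩ : Nonempty ((star a).edgeSet ↪ T) :=
    Function.Embedding.nonempty_of_card_le (by rw [hca]; exact hT)
  obtain ⟨S, h1, -, h3⟩ := exists_disjoint_family
    (fun e S => IsPetal G v (ℓ e - 1) S) (fun e => R (g e)) ∅ D 2 (a * (D + 2))
    (fun i j hij => hR _ _ fun hh => hij (g.injective hh)) (by simp) (fun i => hc _)
    (by rw [hca, card_empty, zero_add]) (by
      intro e X hX hd
      have := hD e
      obtain ⟨S, hS, hSX⟩ := hs (g e) (ℓ e) (hℓ e).1 (hℓ e).2 X (by omega) hd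
      exact ⟨S, hS, by rw [hS.card_eq]; omega, hSX⟩)
  exact isContained_of_petals (fun e => by have := (hℓ e).1; omega) h1 h3

/-- The edges in `M` are pairwise disjoint. -/
def EdgesDisjoint (M : Finset (Sym2 V)) : Prop :=
  ∀ e ∈ M, ∀ f ∈ M, ∀ x, x ∈ e → x ∈ f → e = f

/-- The neighbours of `v` in its class, the edges of `M`, and the edges of `M'` meeting the
neighbourhood of `v` are pairwise disjoint seeds at `v`; `a` of them would give the whole
ballooning. -/
lemma IsNearBipartition.constraint (h : IsNearBipartition G n A)
    {a : ℕ} {ℓ : (star a).edgeSet → ℕ} (hℓ : ∀ e, 5 ≤ ℓ e ∧ Odd (ℓ e))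
    {D : ℕ} (hD : ∀ e, ℓ e ≤ D) (hn : 8 * (a * (D + 2) + D + 5) < n)
    (hG : (ballooning (star a) ℓ).Free G) {v : V} (hv : v ∈ A) {M M' : Finset (Sym2 V)}
    (hM : EdgesDisjoint M) (hMG : ∀ e ∈ M, e ∈ G.edgeSet) (hMA : ∀ e ∈ M, ∀ x ∈ e, x ∈ A)
    (hMv : ∀ e ∈ M, ∀ x ∈ e, x ≠ v ∧ ¬ G.Adj v x)
    (hM' : EdgesDisjoint M') (hMG' : ∀ e ∈ M', e ∈ G.edgeSet) (hMA' : ∀ e ∈ M', ∀ x ∈ e, x ∉ A) :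
    (G.neighborFinset v ∩ A).card + M.card + (M'.filter fun e => ∃ x ∈ e, G.Adj v x).card < a := by
  by_contra! hcon
  let M'' := M'.filter fun e => ∃ x ∈ e, G.Adj v x
  have hM'' : ∀ e ∈ M'', e ∈ M' ∧ ∃ x ∈ e, G.Adj v x := fun e he => mem_filter.1 he
  have hcard : ∀ e : Sym2 V, e ∈ G.edgeSet → e.toFinset.card ≤ 2 := fun e he =>
    (Sym2.card_toFinset_of_not_isDiag e (G.not_isDiag_of_mem_edgeSet he)).le
  refine hG (isContained_of_seeds (G := G) hℓ hD hn (v := v)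
    (T := ↥(G.neighborFinset v ∩ A) ⊕ (↥M ⊕ ↥M''))
    (Sum.elim (fun x => {x.1}) (Sum.elim (fun e => e.1.toFinset) fun e => e.1.toFinset))
    ?_ ?_ ?_ ?_)
  · rintro (⟨x, hx⟩ | ⟨e, he⟩ | ⟨e, he⟩) (⟨y, hy⟩ | ⟨f, hf⟩ | ⟨f, hf⟩) hne <;>
      rw [Finset.disjoint_left] <;> intro z hz1 hz2 <;>
      simp only [Sum.elim_inl, Sum.elim_inr, mem_singleton, Sym2.mem_toFinset] at hz1 hz2
    · subst hz1; subst hz2; exact hne rfl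
    · subst hz1
      exact (hMv f hf z hz2).2 (by simpa using (mem_inter.1 hx).1)
    · subst hz1
      exact hMA' f (hM'' f hf).1 z hz2 (mem_inter.1 hx).2
    · subst hz2
      exact (hMv e he z hz1).2 (by simpa using (mem_inter.1 hy).1)
    · obtain rfl := hM e he f hf z hz1 hz2; exact hne rfl
    · exact hMA' f (hM'' f hf).1 z hz2 (hMA e he z hz1)
    · subst hz2
      exact hMA' e (hM'' e he).1 z hz1 (mem_inter.1 hy).2
    · exact hMA' e (hM'' e he).1 z hz1 (hMA f hf z hz2)
    · obtain rfl := hM' e (hM'' e he).1 f (hM'' f hf).1 z hz1 hz2; exact hne rfl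
  · rintro (⟨x, hx⟩ | ⟨e, he⟩ | ⟨e, he⟩)
    · simp
    · exact hcard e (hMG e he)
    · exact hcard e (hMG' e (hM'' e he).1)
  · rintro (⟨x, hx⟩ | ⟨e, he⟩ | ⟨e, he⟩)
    · rw [mem_inter, mem_neighborFinset] at hx
      exact h.isSeed_singleton hv hx.2 hx.1
    · have h1 := hMG e he
      have h2 := hMA e he
      have h3 := hMv e he
      simp only [Sum.elim_inr, Sum.elim_inl]
      induction e using Sym2.ind with
      | _ x y =>
        have h4 := h.isSeed_pair hv (h2 x (Sym2.mem_mk_left x y)) (h2 y (Sym2.mem_mk_right x y))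
          h1 (h3 x (Sym2.mem_mk_left x y)).1.symm (h3 y (Sym2.mem_mk_right x y)).1.symm
        convert h4 using 1
        ext z; simp
    · obtain ⟨he', x, hxe, hvx⟩ := hM'' e he
      have h1 := hMG' e he'
      have h2 := hMA' e he'
      obtain ⟨y, rfl⟩ := hxe
      have h4 := h.isSeed_pair_of_adj hv (h2 y (Sym2.mem_mk_right x y)) h1 hvx
      simp only [Sum.elim_inr]
      convert h4 using 1
      ext z; simp
  · simp only [Fintype.card_sum, Fintype.card_coe, M'']
    omega

end Constraint

end OddBallooning

namespace OddBallooning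

/-! ### Weighted edge counts from star-plus-matching bounds -/

section Counting

open SimpleGraph Finset
open scoped Classical

variable {V : Type*}

/-- The edges of `G` with both ends in `A`. -/
noncomputable def insideEdges [Fintype V] (G : SimpleGraph V) (A : Finset V) : Finset (Sym2 V) :=
  univ.filter fun e => e ∈ G.edgeSet ∧ ∀ x ∈ e, x ∈ A

/-- The ends of the edges in `M`. -/
noncomputable def ends (M : Finset (Sym2 V)) : Finset V := M.biUnion fun e => e.toFinset

lemma mem_ends {M : Finset (Sym2 V)} {x : V} : x ∈ ends M ↔ ∃ e ∈ M, x ∈ e := by simp [ends]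

variable [Fintype V]

lemma mem_insideEdges {G : SimpleGraph V} {A : Finset V} {e : Sym2 V} :
    e ∈ insideEdges G A ↔ e ∈ G.edgeSet ∧ ∀ x ∈ e, x ∈ A := by simp [insideEdges]

lemma mk_mem_insideEdges {G : SimpleGraph V} {A : Finset V} {x y : V} :
    s(x, y) ∈ insideEdges G A ↔ G.Adj x y ∧ x ∈ A ∧ y ∈ A := by simp [insideEdges]

lemma card_toFinset_of_mem_insideEdges {G : SimpleGraph V} {A : Finset V} {e : Sym2 V}
    (he : e ∈ insideEdges G A) : e.toFinset.card = 2 :=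
  Sym2.card_toFinset_of_not_isDiag e (G.not_isDiag_of_mem_edgeSet (mem_insideEdges.1 he).1)

lemma ends_subset {G : SimpleGraph V} {A : Finset V} {M : Finset (Sym2 V)}
    (h : M ⊆ insideEdges G A) : ends M ⊆ A := by
  intro x hx
  obtain ⟨e, he, hxe⟩ := mem_ends.1 hx
  exact (mem_insideEdges.1 (h he)).2 x hxe

lemma card_ends {G : SimpleGraph V} {A : Finset V} {M : Finset (Sym2 V)}
    (h : M ⊆ insideEdges G A) (hM : EdgesDisjoint M) : (ends M).card = 2 * M.card := by
  rw [ends, card_biUnion]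
  · rw [sum_congr rfl fun e he => card_toFinset_of_mem_insideEdges (h he), sum_const, smul_eq_mul,
      mul_comm]
  · intro e he f hf hne
    simp only [Function.onFun]
    rw [Finset.disjoint_left]
    intro x hx hx'
    exact hne (hM e he f hf x (Sym2.mem_toFinset.1 hx) (Sym2.mem_toFinset.1 hx'))

lemma exists_maximal_edgesDisjoint (E : Finset (Sym2 V)) :
    ∃ M ⊆ E, EdgesDisjoint M ∧ ∀ e ∈ E, ∃ x ∈ e, x ∈ ends M := by
  obtain ⟨M, hM, hmax⟩ := exists_max_image (E.powerset.filter fun M => EdgesDisjoint M) card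
    ⟨∅, mem_filter.2 ⟨empty_mem_powerset _, by simp [EdgesDisjoint]⟩⟩
  rw [mem_filter, mem_powerset] at hM
  refine ⟨M, hM.1, hM.2, ?_⟩
  intro e he
  by_contra! hcon
  have heM : e ∉ M := by
    intro h
    induction e using Sym2.ind with
    | _ x y => exact hcon x (Sym2.mem_mk_left x y) (mem_ends.2 ⟨_, h, Sym2.mem_mk_left x y⟩)
  have := hmax (insert e M) (by
    rw [mem_filter, mem_powerset]
    refine ⟨insert_subset he hM.1, ?_⟩
    intro f hf g hg x hxf hxg
    rcases mem_insert.1 hf with rfl | hf' <;> rcases mem_insert.1 hg with rfl | hg'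
    · rfl
    · exact absurd (mem_ends.2 ⟨g, hg', hxg⟩) (hcon x hxf)
    · exact absurd (mem_ends.2 ⟨f, hf', hxf⟩) (hcon x hxg)
    · exact hM.2 f hf' g hg' x hxf hxg)
  rw [card_insert_of_notMem heM] at this
  omega

/-- Summing degrees over a vertex cover counts every edge at least once, and those of `M`, having
both ends in the cover, twice. -/
lemma card_add_card_le_sum (G : SimpleGraph V) (A : Finset V) {M : Finset (Sym2 V)} {C : Finset V}
    (hM : M ⊆ insideEdges G A) (hC : ∀ e ∈ insideEdges G A, ∃ x ∈ e, x ∈ C)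
    (hMC : ∀ e ∈ M, ∀ x ∈ e, x ∈ C) :
    (insideEdges G A).card + M.card ≤ ∑ x ∈ C, (G.neighborFinset x ∩ A).card := by
  have h1 : ∀ x ∈ C, ((insideEdges G A).filter fun e => x ∈ e).card ≤
      (G.neighborFinset x ∩ A).card := by
    intro x _
    refine (card_le_card ?_).trans (card_image_le (s := G.neighborFinset x ∩ A)
      (f := fun y => s(x, y)))
    intro e he
    obtain ⟨he, y, rfl⟩ := mem_filter.1 he
    rw [mk_mem_insideEdges] at he
    exact mem_image.2 ⟨y, by simp [he.1, he.2.2], rfl⟩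
  refine le_trans ?_ (sum_le_sum h1)
  have h2 := sum_card_bipartiteAbove_eq_sum_card_bipartiteBelow (fun (x : V) (e : Sym2 V) => x ∈ e)
    (s := C) (t := insideEdges G A)
  simp only [bipartiteAbove, bipartiteBelow] at h2
  rw [h2]
  have h3 : ∀ e ∈ insideEdges G A, (1 + if e ∈ M then 1 else 0) ≤
      (C.filter fun x => x ∈ e).card := by
    intro e he
    split_ifs with heM
    · rw [one_add_one_eq_two, ← card_toFinset_of_mem_insideEdges he]
      refine card_le_card fun x hx => ?_
      rw [Sym2.mem_toFinset] at hx
      exact mem_filter.2 ⟨hMC e heM x hx, hx⟩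
    · obtain ⟨x, hx, hxC⟩ := hC e he
      exact card_pos.2 ⟨x, mem_filter.2 ⟨hxC, hx⟩⟩
  refine le_trans ?_ (sum_le_sum h3)
  rw [sum_add_distrib, ← card_filter, sum_const, smul_eq_mul, mul_one, filter_mem_eq_inter,
    inter_eq_right.2 hM]

/-- Take a maximal matching avoiding `v` and its neighbours. The cover does not need `v`: an edge at
`v` is covered by its other end. -/
lemma exists_matching_away (G : SimpleGraph V) {A : Finset V} (v : V) (hv : v ∈ A) :
    ∃ M ⊆ insideEdges G A, EdgesDisjoint M ∧ (∀ e ∈ M, ∀ x ∈ e, x ≠ v ∧ ¬ G.Adj v x) ∧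
      ∀ e ∈ insideEdges G A, ∃ x ∈ e, x ∈ (G.neighborFinset v ∩ A) ∪ ends M := by
  obtain ⟨M, h1, h2, h3⟩ := exists_maximal_edgesDisjoint
    ((insideEdges G A).filter fun e => ∀ x ∈ e, x ≠ v ∧ ¬ G.Adj v x)
  refine ⟨M, h1.trans (filter_subset _ _), h2, fun e he => (mem_filter.1 (h1 he)).2, ?_⟩
  intro e he
  by_cases hav : ∀ x ∈ e, x ≠ v ∧ ¬ G.Adj v x
  · obtain ⟨x, hx, hxM⟩ := h3 e (mem_filter.2 ⟨he, hav⟩)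
    exact ⟨x, hx, mem_union_right _ hxM⟩
  · push Not at hav
    obtain ⟨x, hx, hxv⟩ := hav
    by_cases hxe : x = v
    · subst hxe
      obtain ⟨y, rfl⟩ := hx
      rw [mk_mem_insideEdges] at he
      exact ⟨y, Sym2.mem_mk_right _ _, mem_union_left _ (by simp [he.1, he.2.2])⟩
    · exact ⟨x, hx, mem_union_left _ (by
        simp [hxv hxe, (mem_insideEdges.1 he).2 x hx])⟩

/-- The ends of a maximal matching form a cover with `2 * M.card` vertices of degree at most `h + b
x`, and the matching edges are counted twice. -/
lemma card_insideEdges_le_of_matching {G : SimpleGraph V} {A : Finset V} {b : V → ℕ} {h : ℤ}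
    (hh : ∀ x ∈ A, ((G.neighborFinset x ∩ A).card : ℤ) ≤ h + b x) {M : Finset (Sym2 V)}
    (hM : M ⊆ insideEdges G A) (hMd : EdgesDisjoint M)
    (hmax : ∀ e ∈ insideEdges G A, ∃ x ∈ e, x ∈ ends M) :
    ((insideEdges G A).card : ℤ) - ∑ x ∈ A, (b x : ℤ) ≤ M.card * (2 * h - 1) := by
  have h1 := card_add_card_le_sum G A hM hmax fun e he x hx => mem_ends.2 ⟨e, he, hx⟩
  have hs := ends_subset hM
  have h2 : ∑ x ∈ ends M, ((G.neighborFinset x ∩ A).card : ℤ) ≤ ∑ x ∈ ends M, (h + b x) :=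
    sum_le_sum fun x hx => hh x (hs hx)
  have h3 : ∑ x ∈ ends M, (b x : ℤ) ≤ ∑ x ∈ A, (b x : ℤ) :=
    sum_le_sum_of_subset_of_nonneg hs fun _ _ _ => by positivity
  rw [sum_add_distrib, sum_const, card_ends hM hMd, nsmul_eq_mul] at h2
  have h1' : ((insideEdges G A).card : ℤ) + M.card ≤
    ∑ x ∈ ends M, ((G.neighborFinset x ∩ A).card : ℤ) := by exact_mod_cast h1
  push_cast at h2
  linarith

/-- The combinatorial form of the absence of odd cycles through a common vertex: a star together
with a disjoint matching has at most `K + b v` edges, where `v` is the centre of the star. -/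
def StarMatchingBound (G : SimpleGraph V) (A : Finset V) (b : V → ℕ) (K : ℤ) : Prop :=
  ∀ v ∈ A, ∀ M ⊆ insideEdges G A, EdgesDisjoint M → (∀ e ∈ M, ∀ x ∈ e, x ≠ v ∧ ¬ G.Adj v x) →
    ((G.neighborFinset v ∩ A).card : ℤ) + M.card ≤ K + b v

lemma StarMatchingBound.card_le {G : SimpleGraph V} {A : Finset V} {b : V → ℕ} {K : ℤ}
    (hK : StarMatchingBound G A b K) (x : V) (hx : x ∈ A) :
    ((G.neighborFinset x ∩ A).card : ℤ) ≤ K + b x := by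
  simpa using hK x hx ∅ (empty_subset _) (by simp [EdgesDisjoint]) (by simp)

/-- The same count with the cover formed by the neighbours of `v` and the ends of a matching away
from them; it gains when the degree of `v` is large. -/
lemma card_insideEdges_le_of_max {G : SimpleGraph V} {A : Finset V} {b : V → ℕ} {h : ℤ}
    {v : V} (hv : v ∈ A) (hvh : ((G.neighborFinset v ∩ A).card : ℤ) = h + b v) (h0 : 0 ≤ h)
    (hh : ∀ x ∈ A, ((G.neighborFinset x ∩ A).card : ℤ) ≤ h + b x) {M : Finset (Sym2 V)}
    (hM : M ⊆ insideEdges G A) (hMd : EdgesDisjoint M)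
    (hMv : ∀ e ∈ M, ∀ x ∈ e, x ≠ v ∧ ¬ G.Adj v x)
    (hmax : ∀ e ∈ insideEdges G A, ∃ x ∈ e, x ∈ (G.neighborFinset v ∩ A) ∪ ends M) :
    ((insideEdges G A).card : ℤ) - ∑ x ∈ A, (b x : ℤ) ≤
      h ^ 2 + b v * (h - 1) + M.card * (2 * h - 1) := by
  have h1 := card_add_card_le_sum G A hM hmax
    fun e he x hx => mem_union_right _ (mem_ends.2 ⟨e, he, hx⟩)
  -- The cover avoids `v`, so the weight `b v` is saved; this turns `b v * h` into `b v * (h - 1)`.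
  have hs : (G.neighborFinset v ∩ A) ∪ ends M ⊆ A.erase v := by
    refine union_subset (fun x hx => ?_) fun x hx => ?_
    · rw [mem_inter, mem_neighborFinset] at hx
      exact mem_erase.2 ⟨hx.1.ne', hx.2⟩
    · obtain ⟨e, he, hxe⟩ := mem_ends.1 hx
      exact mem_erase.2 ⟨(hMv e he x hxe).1, ends_subset hM hx⟩
  generalize hCdef : (G.neighborFinset v ∩ A) ∪ ends M = C at *
  have h2 : ∑ x ∈ C, ((G.neighborFinset x ∩ A).card : ℤ) ≤ ∑ x ∈ C, (h + b x) :=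
    sum_le_sum fun x hx => hh x (mem_of_mem_erase (hs hx))
  have h3 : ∑ x ∈ C, (b x : ℤ) ≤ ∑ x ∈ A.erase v, (b x : ℤ) :=
    sum_le_sum_of_subset_of_nonneg hs fun _ _ _ => by positivity
  have h4 := add_sum_erase A (fun x => (b x : ℤ)) hv
  have h5 : (C.card : ℤ) ≤ (h + b v) + 2 * M.card := by
    rw [← hvh]
    have := card_union_le (G.neighborFinset v ∩ A) (ends M)
    rw [hCdef, card_ends hM hMd] at this
    exact_mod_cast this
  rw [sum_add_distrib, sum_const, nsmul_eq_mul] at h2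
  have h1' : ((insideEdges G A).card : ℤ) + M.card ≤
    ∑ x ∈ C, ((G.neighborFinset x ∩ A).card : ℤ) := by exact_mod_cast h1
  have h6 := mul_le_mul_of_nonneg_right h5 h0
  linarith

/-- Either the number of edges inside `A`, less the total weight, is negative, or it is bounded by
the square of `K` up to an error controlled by the largest weight. -/
lemma card_insideEdges_le_sq {G : SimpleGraph V} {A : Finset V} {b : V → ℕ} {K : ℤ} {r : ℕ}
    (hK : StarMatchingBound G A b K) (hb : ∀ x, b x ≤ r) (hA : A.Nonempty) {M : Finset (Sym2 V)}
    (hM : M ⊆ insideEdges G A) (hMd : EdgesDisjoint M)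
    (hmax : ∀ e ∈ insideEdges G A, ∃ x ∈ e, x ∈ ends M) :
    ((insideEdges G A).card : ℤ) - ∑ x ∈ A, (b x : ℤ) ≤ - M.card ∨
      1 ≤ K ∧ ((insideEdges G A).card : ℤ) - ∑ x ∈ A, (b x : ℤ) ≤ K ^ 2 + r * (K - 1) := by
  obtain ⟨v, hv, hvmax⟩ := exists_max_image A
    (fun x => ((G.neighborFinset x ∩ A).card : ℤ) - b x) hA
  obtain ⟨h, hh⟩ : ∃ h : ℤ, h = ((G.neighborFinset v ∩ A).card : ℤ) - b v := ⟨_, rfl⟩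
  have hle : ∀ x ∈ A, ((G.neighborFinset x ∩ A).card : ℤ) ≤ h + b x := fun x hx => by
    have := hvmax x hx
    linarith
  rcases le_or_gt h 0 with h0 | h0
  · left
    have := card_insideEdges_le_of_matching hle hM hMd hmax
    have h1 : (M.card : ℤ) * h ≤ 0 := mul_nonpos_of_nonneg_of_nonpos (by positivity) h0
    linarith
  · right
    obtain ⟨N, h1, h2, h3, h4⟩ := exists_matching_away G v hv
    have h5 := card_insideEdges_le_of_max hv (by linarith) h0.le hle h1 h2 h3 h4
    have h6 := hK v hv N h1 h2 h3
    have h7 : (N.card : ℤ) ≤ K - h := by linarith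
    have h8 : (0 : ℤ) ≤ N.card := by positivity
    have h9 : (b v : ℤ) ≤ r := by exact_mod_cast hb v
    have h10 : (N.card : ℤ) * (2 * h - 1) ≤ (K - h) * (2 * h - 1) :=
      mul_le_mul_of_nonneg_right h7 (by linarith)
    have h11 : (b v : ℤ) * (h - 1) ≤ r * (K - 1) :=
      mul_le_mul h9 (by linarith) (by linarith) (by positivity)
    refine ⟨by linarith, ?_⟩
    -- Here `h ^ 2 + (K - h) * (2 * h - 1) = K ^ 2 - (K - h) ^ 2 - (K - h)`.
    nlinarith [sq_nonneg (K - h)]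

lemma card_insideEdges_le_of_zero {G : SimpleGraph V} {A : Finset V} {k : ℕ}
    (hK : StarMatchingBound G A (fun _ => 0) k) : (insideEdges G A).card ≤ k ^ 2 := by
  rcases A.eq_empty_or_nonempty with rfl | hA
  · have : insideEdges G ∅ = ∅ := by
      ext e
      induction e using Sym2.ind with
      | _ x y => simp [mk_mem_insideEdges]
    simp [this]
  obtain ⟨M, h1, h2, h3⟩ := exists_maximal_edgesDisjoint (insideEdges G A)
  have := card_insideEdges_le_sq (r := 0) hK (by simp) hA h1 h2 h3
  simp only [Nat.cast_zero, sum_const_zero, zero_mul, sub_zero, add_zero] at this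
  zify
  rcases this with h | h
  · have : (0 : ℤ) ≤ M.card := by positivity
    have : (0 : ℤ) ≤ (k : ℤ) ^ 2 := by positivity
    linarith
  · exact h.2

/-- Equality forces a vertex with `k` neighbours `X`. Its star leaves no room for a disjoint
matching edge, so `X` covers all edges; then `k ^ 2` edges force every vertex of `X` to have degree
`k` and `X` to be independent. The neighbourhood `Y` of one vertex of `X` is also a cover, hence
contains, and by size equals, that of every other. -/
lemma exists_biclique_of_card_eq {G : SimpleGraph V} {A : Finset V} {k : ℕ} (hk : 1 ≤ k)
    (hK : StarMatchingBound G A (fun _ => 0) k) (hcard : (insideEdges G A).card = k ^ 2) :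
    ∃ X Y : Finset V, X ⊆ A ∧ Y ⊆ A ∧ Disjoint X Y ∧ X.card = k ∧ Y.card = k ∧
      ∀ u ∈ A, ∀ w ∈ A, G.Adj u w ↔ (u ∈ X ∧ w ∈ Y) ∨ (u ∈ Y ∧ w ∈ X) := by
  have hdeg : ∀ x ∈ A, (G.neighborFinset x ∩ A).card ≤ k := fun x hx => by
    have := hK.card_le x hx
    simpa using this
  have hAne : A.Nonempty := by
    by_contra hA
    rw [not_nonempty_iff_eq_empty] at hA
    have : insideEdges G A = ∅ := by
      rw [hA]; ext e
      induction e using Sym2.ind with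
      | _ x y => simp [mk_mem_insideEdges]
    rw [this, card_empty] at hcard
    exact absurd hcard.symm (by positivity)
  have hfull : ∀ x ∈ A, (G.neighborFinset x ∩ A).card = k →
      ∀ e ∈ insideEdges G A, ∃ y ∈ e, y ∈ G.neighborFinset x ∩ A := by
    intro x hx hxk e he
    obtain ⟨N, h1, h2, h3, h4⟩ := exists_matching_away G x hx
    have h6 := hK x hx N h1 h2 h3
    rw [hxk] at h6
    have h7 : N = ∅ := by
      rw [← card_eq_zero]; simp at h6; simpa using h6
    obtain ⟨y, hy, hy'⟩ := h4 e he
    exact ⟨y, hy, by simpa [h7, ends] using hy'⟩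
  obtain ⟨v, hv, hvmax⟩ := exists_max_image A (fun x => (G.neighborFinset x ∩ A).card) hAne
  have hvk : (G.neighborFinset v ∩ A).card = k := by
    obtain ⟨N, h1, h2, h3, h4⟩ := exists_matching_away G v hv
    have h5 := card_insideEdges_le_of_max (b := fun _ => 0)
      (h := ((G.neighborFinset v ∩ A).card : ℤ)) hv (by simp) (by positivity)
      (fun x hx => by simpa using hvmax x hx) h1 h2 h3 h4
    have h6 := hK v hv N h1 h2 h3
    have h7 := hdeg v hv
    generalize (G.neighborFinset v ∩ A).card = h at *
    simp only [Nat.cast_zero, sum_const_zero, zero_mul, sub_zero, add_zero, hcard] at h5 h6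
    push_cast at h5
    rcases Nat.eq_zero_or_pos h with rfl | hpos
    · have : (1 : ℤ) ≤ k := by exact_mod_cast hk
      have : (0 : ℤ) ≤ N.card := by positivity
      simp only [Nat.cast_zero] at h5
      nlinarith
    · have e1 : (1 : ℤ) ≤ h := by exact_mod_cast hpos
      have e2 : (h : ℤ) ≤ k := by exact_mod_cast h7
      have e3 : (N.card : ℤ) * (2 * h - 1) ≤ (k - h) * (2 * h - 1) :=
        mul_le_mul_of_nonneg_right (by linarith) (by linarith)
      have e4 : ((k : ℤ) - h) ^ 2 + (k - h) ≤ 0 := by nlinarith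
      have e5 : (k : ℤ) - h ≤ 0 := by nlinarith [sq_nonneg ((k : ℤ) - h)]
      have : (k : ℤ) = h := by linarith
      exact_mod_cast this.symm
  obtain ⟨X, hX⟩ : ∃ X, X = G.neighborFinset v ∩ A := ⟨_, rfl⟩
  have hXA : X ⊆ A := hX ▸ inter_subset_right
  have hXk : X.card = k := hX ▸ hvk
  have hcov : ∀ e ∈ insideEdges G A, ∃ y ∈ e, y ∈ X := hX ▸ hfull v hv hvk
  have hsum : ∑ x ∈ X, (G.neighborFinset x ∩ A).card ≤ k ^ 2 := by
    refine (sum_le_sum fun x hx => hdeg x (hXA hx)).trans ?_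
    rw [sum_const, hXk, smul_eq_mul, sq]
  have hXdeg : ∀ x ∈ X, (G.neighborFinset x ∩ A).card = k := by
    intro x hx
    by_contra hne
    have h1 : ∑ x ∈ X, (G.neighborFinset x ∩ A).card < ∑ x ∈ X, k :=
      sum_lt_sum (fun x hx => hdeg x (hXA hx)) ⟨x, hx, lt_of_le_of_ne (hdeg x (hXA hx)) hne⟩
    rw [sum_const, hXk, smul_eq_mul, ← sq, ← hcard] at h1
    have h2 := card_add_card_le_sum G A (empty_subset _) hcov (by simp)
    omega
  -- An edge inside `X` would be counted twice in the degree sum over `X`, which is exactly used up.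
  have hXind : ∀ x ∈ X, ∀ y ∈ X, ¬ G.Adj x y := by
    intro x hx y hy hxy
    have h2 := card_add_card_le_sum G A (M := {s(x, y)})
      (by simp [mk_mem_insideEdges, hxy, hXA hx, hXA hy]) hcov (by simp [hx, hy])
    rw [card_singleton] at h2
    omega
  obtain ⟨x₀, hx₀⟩ : X.Nonempty := card_pos.1 (by omega)
  obtain ⟨Y, hY⟩ : ∃ Y, Y = G.neighborFinset x₀ ∩ A := ⟨_, rfl⟩
  have hYA : Y ⊆ A := hY ▸ inter_subset_right
  have hYk : Y.card = k := hY ▸ hXdeg x₀ hx₀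
  have hXY : ∀ x ∈ X, ∀ y ∈ A, G.Adj x y ↔ y ∈ Y := by
    intro x hx
    have hsub : G.neighborFinset x ∩ A ⊆ Y := by
      intro y hy
      rw [mem_inter, mem_neighborFinset] at hy
      obtain ⟨z, hz, hz'⟩ := hfull x₀ (hXA hx₀) (hXdeg x₀ hx₀) s(x, y)
        (mk_mem_insideEdges.2 ⟨hy.1, hXA hx, hy.2⟩)
      rcases Sym2.mem_iff.1 hz with rfl | rfl
      · rw [mem_inter, mem_neighborFinset] at hz'
        exact absurd hz'.1 (hXind _ hx₀ _ hx)
      · exact hY ▸ hz'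
    have heq := eq_of_subset_of_card_le hsub (by rw [hYk, hXdeg x hx])
    intro y hy
    rw [← heq, mem_inter, mem_neighborFinset]
    simp [hy]
  refine ⟨X, Y, hXA, hYA, ?_, hXk, hYk, ?_⟩
  · rw [Finset.disjoint_left]
    intro x hx hxY
    exact hXind x₀ hx₀ x hx ((hXY x₀ hx₀ x (hXA hx)).2 hxY)
  · intro u hu w hw
    constructor
    · intro huw
      obtain ⟨z, hz, hzX⟩ := hcov s(u, w) (mk_mem_insideEdges.2 ⟨huw, hu, hw⟩)
      rcases Sym2.mem_iff.1 hz with rfl | rfl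
      · exact Or.inl ⟨hzX, (hXY _ hzX _ hw).1 huw⟩
      · exact Or.inr ⟨(hXY _ hzX _ hu).1 huw.symm, hzX⟩
    · rintro (⟨h1, h2⟩ | ⟨h1, h2⟩)
      · exact (hXY u h1 w hw).2 h2
      · exact ((hXY w h2 u hu).2 h1).symm

end Counting

end OddBallooning

namespace OddBallooning

/-! ### Comparing inner edges with missing cross edges -/

section Structure

open SimpleGraph Finset
open scoped Classical

variable {V : Type*} [Fintype V]

lemma card_edgeFinset_add_missing (G : SimpleGraph V) (A : Finset V) :
    G.edgeFinset.card + ∑ x ∈ A, (Aᶜ \ G.neighborFinset x).card =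
      A.card * (Aᶜ).card + (insideEdges G A).card + (insideEdges G Aᶜ).card := by
  let cross : Finset (V × V) := (A ×ˢ Aᶜ).filter fun p => G.Adj p.1 p.2
  have hcross : cross.card = ∑ x ∈ A, (Aᶜ ∩ G.neighborFinset x).card := by
    simp only [cross]
    rw [card_filter, sum_product]
    refine sum_congr rfl fun x _ => ?_
    rw [← card_filter]
    congr 1
    ext y; simp
  have hprod : ∑ x ∈ A, (Aᶜ ∩ G.neighborFinset x).card +
      ∑ x ∈ A, (Aᶜ \ G.neighborFinset x).card = A.card * (Aᶜ).card := by
    rw [← sum_add_distrib, ← smul_eq_mul, ← sum_const]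
    exact sum_congr rfl fun x _ => card_inter_add_card_sdiff _ _
  have himg : (cross.image fun p => s(p.1, p.2)).card = cross.card := by
    refine card_image_of_injOn ?_
    rintro ⟨x, y⟩ hp ⟨x', y'⟩ hp' h
    simp only [cross, coe_filter, mem_product, mem_compl, Set.mem_ofPred_eq] at hp hp'
    rcases Sym2.eq_iff.1 h with ⟨rfl, rfl⟩ | ⟨rfl, rfl⟩
    · rfl
    · exact absurd hp.1.1 hp'.1.2
  have hunion : G.edgeFinset =
      insideEdges G A ∪ (insideEdges G Aᶜ ∪ cross.image fun p => s(p.1, p.2)) := by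
    ext e
    induction e using Sym2.ind with
    | _ x y =>
      simp only [mem_edgeFinset, mem_edgeSet, mem_union, mk_mem_insideEdges, mem_image, cross,
        mem_filter, mem_product, mem_compl, Prod.exists]
      constructor
      · intro h
        by_cases hx : x ∈ A <;> by_cases hy : y ∈ A
        · tauto
        · exact Or.inr (Or.inr ⟨x, y, ⟨⟨hx, hy⟩, h⟩, rfl⟩)
        · exact Or.inr (Or.inr ⟨y, x, ⟨⟨hy, hx⟩, h.symm⟩, Sym2.eq_swap⟩)
        · tauto
      · rintro (h | h | ⟨u, w, h, he⟩)
        · exact h.1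
        · exact h.1
        · rcases Sym2.eq_iff.1 he with ⟨rfl, rfl⟩ | ⟨rfl, rfl⟩
          · exact h.2
          · exact h.2.symm
  have hd1 : Disjoint (insideEdges G Aᶜ) (cross.image fun p => s(p.1, p.2)) := by
    rw [Finset.disjoint_left]
    intro e he he'
    obtain ⟨⟨u, w⟩, h, rfl⟩ := mem_image.1 he'
    simp only [cross, mem_filter, mem_product, mem_compl] at h
    exact mem_compl.1 (mk_mem_insideEdges.1 he).2.1 h.1.1
  have hd2 : Disjoint (insideEdges G A)
      (insideEdges G Aᶜ ∪ cross.image fun p => s(p.1, p.2)) := by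
    rw [disjoint_union_right]
    constructor <;> rw [Finset.disjoint_left]
    · intro e he he'
      induction e using Sym2.ind with
      | _ x y =>
        exact mem_compl.1 (mk_mem_insideEdges.1 he').2.1 (mk_mem_insideEdges.1 he).2.1
    · intro e he he'
      obtain ⟨⟨u, w⟩, h, rfl⟩ := mem_image.1 he'
      simp only [cross, mem_filter, mem_product, mem_compl] at h
      exact h.1.2 (mk_mem_insideEdges.1 he).2.2
  rw [hunion, card_union_of_disjoint hd2, card_union_of_disjoint hd1, himg, hcross]
  omega

/-- The number of edges in `M` both of whose ends are not adjacent to `x`. -/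
noncomputable def missedEdges (G : SimpleGraph V) (M : Finset (Sym2 V)) (x : V) : ℕ :=
  (M.filter fun e => ¬ ∃ y ∈ e, G.Adj x y).card

/-- Both ends of a missed edge are non-neighbours of `x`, and the edges are disjoint. -/
lemma two_mul_missedEdges_le {G : SimpleGraph V} {B : Finset V} {M : Finset (Sym2 V)}
    (hM : M ⊆ insideEdges G B) (hMd : EdgesDisjoint M) (x : V) :
    2 * missedEdges G M x ≤ (B \ G.neighborFinset x).card := by
  rw [missedEdges, ← card_ends ((filter_subset _ _).trans hM)
    fun e he f hf => hMd e (mem_filter.1 he).1 f (mem_filter.1 hf).1]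
  refine card_le_card fun y hy => ?_
  obtain ⟨e, he, hye⟩ := mem_ends.1 hy
  rw [mem_filter] at he
  rw [mem_sdiff, mem_neighborFinset]
  exact ⟨(mem_insideEdges.1 (hM he.1)).2 y hye, fun hxy => he.2 ⟨y, hye, hxy⟩⟩

/-- A matching in the other class uses up `M.card` of the `a - 1` admissible seeds, except for the
edges that `v` does not see; these become the weight of `v`. -/
lemma IsNearBipartition.starMatchingBound {G : SimpleGraph V} {n : ℕ} {A : Finset V}
    (h : IsNearBipartition G n A)
    {a : ℕ} {ℓ : (star a).edgeSet → ℕ} (hℓ : ∀ e, 5 ≤ ℓ e ∧ Odd (ℓ e))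
    {D : ℕ} (hD : ∀ e, ℓ e ≤ D) (hn : 8 * (a * (D + 2) + D + 5) < n)
    (hG : (ballooning (star a) ℓ).Free G) {M : Finset (Sym2 V)} (hM : M ⊆ insideEdges G Aᶜ)
    (hMd : EdgesDisjoint M) :
    StarMatchingBound G A (missedEdges G M) ((a : ℤ) - 1 - M.card) := by
  intro v hv N hN hNd hNv
  have h1 := h.constraint hℓ hD hn hG hv hNd (fun e he => (mem_insideEdges.1 (hN he)).1)
    (fun e he => (mem_insideEdges.1 (hN he)).2) hNv hMd
    (fun e he => (mem_insideEdges.1 (hM he)).1)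
    (fun e he x hx => mem_compl.1 ((mem_insideEdges.1 (hM he)).2 x hx))
  have h2 := card_filter_add_card_filter_not (s := M) (fun e => ∃ y ∈ e, G.Adj v y)
  have h3 : missedEdges G M v = (M.filter fun e => ¬ ∃ y ∈ e, G.Adj v y).card := rfl
  omega

lemma weight_lt_of_two_mul_le {k r s : ℤ} (hr : 1 ≤ r) (hrs : r ≤ s) (hs : 2 * s ≤ k) :
    s * (2 * (k - r) - 1) + r * (2 * (k - s) - 1) < k ^ 2 := by
  nlinarith [mul_nonneg (sub_nonneg.2 hs) (sub_nonneg.2 (show 2 * r ≤ k by linarith))]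

lemma weight_lt_of_lt_two_mul {k r s : ℤ} (hr : 1 ≤ r) (hs : k < 2 * s) :
    (k - r) ^ 2 + r * (k - r - 1) + r * (2 * (k - s) - 1) < k ^ 2 := by
  nlinarith [mul_pos (show 0 < r by linarith) (show 0 < 2 * s + 2 - k by linarith)]

lemma neg_weight_lt {k r s : ℤ} (hk : 1 ≤ k) (hr : 1 ≤ r) (hrs : r ≤ s) (hs : k < 2 * s) :
    -s + r * (2 * (k - s) - 1) < k ^ 2 := by
  rcases le_or_gt k s with h | h
  · nlinarith
  · have : r * (2 * (k - s) - 1) ≤ s * (2 * (k - s) - 1) :=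
      mul_le_mul_of_nonneg_right hrs (by linarith)
    nlinarith

/-- Let `k = a - 1` and let `r ≤ s` be the sizes of the maximal matchings in `Aᶜ` and `A`. If `r =
0`, all weights on `A` vanish and the unweighted bound with its equality case applies. If `r ≥ 1`,
the weighted bounds for the two classes add up to less than `k ^ 2`, a contradiction. -/
lemma IsNearBipartition.structure_aux {G : SimpleGraph V} {n : ℕ} {A : Finset V}
    (h : IsNearBipartition G n A) (hV : Fintype.card V = n)
    {a : ℕ} (ha : 2 ≤ a) {ℓ : (star a).edgeSet → ℕ} (hℓ : ∀ e, 5 ≤ ℓ e ∧ Odd (ℓ e))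
    {D : ℕ} (hD : ∀ e, ℓ e ≤ D) (hn : 8 * (a * (D + 2) + D + 5) < n)
    (hG : (ballooning (star a) ℓ).Free G) (hE : n ^ 2 / 4 + (a - 1) ^ 2 ≤ G.edgeFinset.card)
    {MA MB : Finset (Sym2 V)} (hA : MA ⊆ insideEdges G A) (hAd : EdgesDisjoint MA)
    (hAm : ∀ e ∈ insideEdges G A, ∃ x ∈ e, x ∈ ends MA)
    (hB : MB ⊆ insideEdges G Aᶜ) (hBd : EdgesDisjoint MB)
    (hBm : ∀ e ∈ insideEdges G Aᶜ, ∃ x ∈ e, x ∈ ends MB) (hAB : MB.card ≤ MA.card) :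
    G.edgeFinset.card = n ^ 2 / 4 + (a - 1) ^ 2 ∧ A.card * (Aᶜ).card = n ^ 2 / 4 ∧
      insideEdges G Aᶜ = ∅ ∧ (∀ x ∈ A, ∀ y ∉ A, G.Adj x y) ∧
      ∃ X Y : Finset V, X ⊆ A ∧ Y ⊆ A ∧ Disjoint X Y ∧ X.card = a - 1 ∧ Y.card = a - 1 ∧
        ∀ u ∈ A, ∀ w ∈ A, G.Adj u w ↔ (u ∈ X ∧ w ∈ Y) ∨ (u ∈ Y ∧ w ∈ X) := by
  obtain ⟨k, rfl⟩ : ∃ k, a = k + 1 := ⟨a - 1, by omega⟩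
  simp only [Nat.add_sub_cancel] at *
  have hcnt := card_edgeFinset_add_missing G A
  have hprod : A.card * (Aᶜ).card ≤ n ^ 2 / 4 := by
    rw [Nat.le_div_iff_mul_le (by norm_num)]
    have : A.card + (Aᶜ).card = n := by rw [card_add_card_compl, hV]
    rw [← this]
    nlinarith [sq_nonneg ((A.card : ℤ) - (Aᶜ).card), four_mul_le_sq_add A.card (Aᶜ).card]
  have hKA := h.starMatchingBound hℓ hD hn hG hB hBd
  have hKB := h.compl.starMatchingBound hℓ hD hn hG (M := MA) (by rwa [compl_compl]) hAd
  have hmA : 2 * ∑ x ∈ A, missedEdges G MB x ≤ ∑ x ∈ A, (Aᶜ \ G.neighborFinset x).card := by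
    rw [mul_sum]
    exact sum_le_sum fun x _ => two_mul_missedEdges_le hB hBd x
  have hmB : 2 * ∑ x ∈ Aᶜ, missedEdges G MA x ≤ ∑ x ∈ A, (Aᶜ \ G.neighborFinset x).card := by
    rw [mul_sum, sum_card_sdiff_neighborFinset_comm]
    exact sum_le_sum fun x _ => two_mul_missedEdges_le hA hAd x
  rcases Nat.eq_zero_or_pos MB.card with h0 | hpos
  · have hBe : insideEdges G Aᶜ = ∅ := by
      rw [eq_empty_iff_forall_notMem]
      intro e he
      obtain ⟨x, -, hx⟩ := hBm e he
      rw [card_eq_zero] at h0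
      simp [h0, ends] at hx
    have hKA0 : StarMatchingBound G A (fun _ => 0) k := by
      intro v hv N h1 h2 h3
      have := hKA v hv N h1 h2 h3
      rw [card_eq_zero] at h0
      simp only [h0, missedEdges, filter_empty, card_empty] at this
      push_cast at this ⊢
      linarith
    have hle := card_insideEdges_le_of_zero hKA0
    rw [hBe, card_empty] at hcnt
    have hm0 : ∑ x ∈ A, (Aᶜ \ G.neighborFinset x).card = 0 := by omega
    refine ⟨by omega, by omega, hBe, ?_, ?_⟩
    · intro x hx y hy
      have h1 := (sum_eq_zero_iff.1 hm0) x hx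
      rw [card_eq_zero, sdiff_eq_empty_iff_subset] at h1
      have := h1 (mem_compl.2 hy)
      rwa [mem_neighborFinset] at this
    · exact exists_biclique_of_card_eq (by omega) hKA0 (by omega)
  · exfalso
    have hk : (1 : ℤ) ≤ k := by exact_mod_cast (by omega : 1 ≤ k)
    have hr : (1 : ℤ) ≤ MB.card := by exact_mod_cast hpos
    have hrs : (MB.card : ℤ) ≤ MA.card := by exact_mod_cast hAB
    have wA := card_insideEdges_le_of_matching hKA.card_le hA hAd hAm
    have wB := card_insideEdges_le_of_matching hKB.card_le hB hBd hBm
    have hAne : A.Nonempty := by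
      have := h.card_left
      exact card_pos.1 (by omega)
    have sA := card_insideEdges_le_sq (r := MB.card) hKA (fun x => card_filter_le _ _) hAne hA hAd
      hAm
    -- By `hmA` and `hmB` the number of missing cross pairs is at least twice the total weight of
    -- either class, hence at least the sum of both total weights.
    have hneed : (k : ℤ) ^ 2 ≤ (insideEdges G A).card + (insideEdges G Aᶜ).card -
        ∑ x ∈ A, ((Aᶜ \ G.neighborFinset x).card : ℤ) := by
      have : (k : ℤ) ^ 2 = ((k ^ 2 : ℕ) : ℤ) := by push_cast; ring
      have h4 : (((A.card * (Aᶜ).card : ℕ) : ℤ)) ≤ ((n ^ 2 / 4 : ℕ) : ℤ) := by exact_mod_cast hprod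
      rw [this, ← Nat.cast_sum]
      omega
    zify at hmA hmB
    have e1 : ((k + 1 : ℕ) : ℤ) - 1 = k := by push_cast; ring
    rw [e1] at wA wB sA
    -- For `2 * s ≤ k` the matching bound serves both classes. For larger `s` it is too weak on `A`,
    -- where the bound through a vertex of maximal weighted degree replaces it.
    rcases le_or_gt (2 * (MA.card : ℤ)) k with h2 | h2
    · have := weight_lt_of_two_mul_le hr hrs h2
      linarith
    · rcases sA with h3 | ⟨-, h3⟩
      · have := neg_weight_lt hk hr hrs h2
        linarith
      · have := weight_lt_of_lt_two_mul hr h2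
        linarith

/-- `G` is the complete bipartite graph between `A` and `Aᶜ` together with a complete bipartite graph
inside `A`, with classes of size `k`. -/
def IsBicliqueInClass (G : SimpleGraph V) (k : ℕ) (A : Finset V) : Prop :=
  (∀ x ∈ A, ∀ y ∉ A, G.Adj x y) ∧ (∀ x ∉ A, ∀ y ∉ A, ¬ G.Adj x y) ∧
    ∃ X Y : Finset V, X ⊆ A ∧ Y ⊆ A ∧ Disjoint X Y ∧ X.card = k ∧ Y.card = k ∧
        ∀ u ∈ A, ∀ w ∈ A, G.Adj u w ↔ (u ∈ X ∧ w ∈ Y) ∨ (u ∈ Y ∧ w ∈ X)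

lemma IsNearBipartition.exists_isBicliqueInClass {G : SimpleGraph V} {n : ℕ} {A : Finset V}
    (h : IsNearBipartition G n A) (hV : Fintype.card V = n)
    {a : ℕ} (ha : 2 ≤ a) {ℓ : (star a).edgeSet → ℕ} (hℓ : ∀ e, 5 ≤ ℓ e ∧ Odd (ℓ e))
    {D : ℕ} (hD : ∀ e, ℓ e ≤ D) (hn : 8 * (a * (D + 2) + D + 5) < n)
    (hG : (ballooning (star a) ℓ).Free G) (hE : n ^ 2 / 4 + (a - 1) ^ 2 ≤ G.edgeFinset.card) :
    G.edgeFinset.card = n ^ 2 / 4 + (a - 1) ^ 2 ∧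
      ∃ B : Finset V, B.card * (Bᶜ).card = n ^ 2 / 4 ∧ IsBicliqueInClass G (a - 1) B := by
  obtain ⟨MA, a1, a2, a3⟩ := exists_maximal_edgesDisjoint (insideEdges G A)
  obtain ⟨MB, b1, b2, b3⟩ := exists_maximal_edgesDisjoint (insideEdges G Aᶜ)
  have hind : ∀ B : Finset V, insideEdges G Bᶜ = ∅ → ∀ x ∉ B, ∀ y ∉ B, ¬ G.Adj x y := by
    intro B hB x hx y hy hxy
    have := mk_mem_insideEdges.2 ⟨hxy, mem_compl.2 hx, mem_compl.2 hy⟩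
    rw [hB] at this
    exact notMem_empty _ this
  rcases le_total MB.card MA.card with hle | hle
  · obtain ⟨h1, h2, h3, h4, h5⟩ := h.structure_aux hV ha hℓ hD hn hG hE a1 a2 a3 b1 b2 b3 hle
    exact ⟨h1, A, h2, h4, hind A h3, h5⟩
  · obtain ⟨h1, h2, h3, h4, h5⟩ := h.compl.structure_aux hV ha hℓ hD hn hG hE b1 b2 b3
      (by rwa [compl_compl]) a2 (by rwa [compl_compl]) hle
    exact ⟨h1, Aᶜ, h2, h4, hind Aᶜ h3, h5⟩

/-- The structure of dense graphs of large minimum degree. -/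
lemma exists_isBicliqueInClass_of_minDegree {G : SimpleGraph V} {n : ℕ}
    (hV : Fintype.card V = n)
    {a : ℕ} (ha : 2 ≤ a) {ℓ : (star a).edgeSet → ℕ} (hℓ : ∀ e, 5 ≤ ℓ e ∧ Odd (ℓ e))
    {D : ℕ} (hD : ∀ e, ℓ e ≤ D) (hn : 4096 * (2 * (a * D + D) + 1) + 8 * (a * (D + 2) + D + 5) < n)
    (hG : (ballooning (star a) ℓ).Free G) (hE : n ^ 2 / 4 + (a - 1) ^ 2 ≤ G.edgeFinset.card)
    (hmin : ∀ v, n / 2 ≤ G.degree v) :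
    G.edgeFinset.card = n ^ 2 / 4 + (a - 1) ^ 2 ∧
      ∃ B : Finset V, B.card * (Bᶜ).card = n ^ 2 / 4 ∧ IsBicliqueInClass G (a - 1) B := by
  obtain ⟨A, h1, h2, h3, h4⟩ := exists_near_complete_bipartition G (L := a * D + D) hV
    (fun v => by rw [card_neighborFinset_eq_degree]; exact hmin v)
    (fun v => by
      rw [← hV]
      exact sum_inner_degree_neighborFinset_le (fun e => by have := (hℓ e).1; omega) hD hG v)
    (by omega)
  exact IsNearBipartition.exists_isBicliqueInClass ⟨h1, h2, h3, h4⟩ hV ha hℓ hD (by omega) hG hE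

end Structure

end OddBallooning

namespace OddBallooning

/-! ### Deleting vertices of small degree -/

section Deletion

open SimpleGraph Finset
open scoped Classical

lemma card_edgeFinset_induce_compl_add {V : Type*} [Fintype V] (G : SimpleGraph V) (v : V) :
    (G.induce {v}ᶜ).edgeFinset.card + G.degree v = G.edgeFinset.card := by
  rw [card_edgeFinset_induce_compl_singleton, card_edgeFinset_deleteIncidenceSet]
  have : G.degree v ≤ G.edgeFinset.card := by
    rw [← card_incidenceFinset_eq_degree]
    exact card_le_card (incidenceFinset_subset G v)
  omega

lemma sq_div_four_succ (n : ℕ) : (n + 1) ^ 2 / 4 = n ^ 2 / 4 + (n + 1) / 2 := by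
  rcases Nat.even_or_odd' n with ⟨m, rfl | rfl⟩
  · have h1 : (2 * m + 1) ^ 2 = 4 * (m ^ 2 + m) + 1 := by ring
    have h2 : (2 * m) ^ 2 = 4 * m ^ 2 := by ring
    omega
  · have h1 : (2 * m + 1) ^ 2 = 4 * (m ^ 2 + m) + 1 := by ring
    have h2 : (2 * m + 1 + 1) ^ 2 = 4 * (m ^ 2 + m + m + 1) := by ring
    omega

variable {a : ℕ} {ℓ : (star a).edgeSet → ℕ} {D : ℕ}

/-- From `N + j + 1` to `N + j` vertices, the Turán number drops by `(N + j + 1) / 2`, more than the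
degree of a deleted vertex. So the excess allowed decreases by one with each added vertex, from the
trivial `N ^ 2` at `j = 0` until it reaches `(a - 1) ^ 2`. -/
lemma card_edgeFinset_le_of_free (ha : 2 ≤ a) (hℓ : ∀ e, 5 ≤ ℓ e ∧ Odd (ℓ e))
    (hD : ∀ e, ℓ e ≤ D) {N : ℕ} (hN : 4096 * (2 * (a * D + D) + 1) + 8 * (a * (D + 2) + D + 5) ≤ N)
    (j : ℕ) : ∀ (V : Type) [Fintype V] (G : SimpleGraph V), Fintype.card V = N + j →
      (ballooning (star a) ℓ).Free G →
      G.edgeFinset.card ≤ (N + j) ^ 2 / 4 + max ((a - 1) ^ 2) (N ^ 2 - j) := by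
  induction j with
  | zero =>
    intro V _ G hV _
    have h1 := G.card_edgeFinset_le_card_choose_two
    have h2 := Nat.choose_le_pow (Fintype.card V) 2
    rw [hV] at h1 h2
    have h3 := le_max_right ((a - 1) ^ 2) (N ^ 2 - 0)
    simp only [Nat.add_zero] at *
    omega
  | succ j ih =>
    intro V _ G hV hG
    by_contra! hcon
    by_cases hmin : ∀ v, (N + (j + 1)) / 2 ≤ G.degree v
    · have h1 := le_max_left ((a - 1) ^ 2) (N ^ 2 - (j + 1))
      have := (exists_isBicliqueInClass_of_minDegree hV ha hℓ hD (by omega) hG (by omega) hmin).1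
      omega
    · push Not at hmin
      obtain ⟨v, hv⟩ := hmin
      have h1 : (G.induce {v}ᶜ).edgeFinset.card ≤
          (N + j) ^ 2 / 4 + max ((a - 1) ^ 2) (N ^ 2 - j) := by
        convert ih ↥({v}ᶜ : Set V) (G.induce {v}ᶜ) (by
          rw [Fintype.card_compl_set, hV]; simp)
          fun h => hG (h.trans (Embedding.induce _).isContained)
      have h2 := card_edgeFinset_induce_compl_add G v
      have h3 := sq_div_four_succ (N + j)
      have h4 : N + (j + 1) = N + j + 1 := rfl
      rw [h4] at hcon hv
      have h5 : max ((a - 1) ^ 2) (N ^ 2 - j) ≤ max ((a - 1) ^ 2) (N ^ 2 - (j + 1)) + 1 := by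
        omega
      omega

lemma exists_isBicliqueInClass_of_card_le (ha : 2 ≤ a) (hℓ : ∀ e, 5 ≤ ℓ e ∧ Odd (ℓ e))
    (hD : ∀ e, ℓ e ≤ D) {N : ℕ} (hN : 4096 * (2 * (a * D + D) + 1) + 8 * (a * (D + 2) + D + 5) ≤ N)
    {V : Type} [Fintype V] {G : SimpleGraph V} {n : ℕ} (hV : Fintype.card V = n)
    (hn : N + N ^ 2 < n) (hG : (ballooning (star a) ℓ).Free G)
    (hE : n ^ 2 / 4 + (a - 1) ^ 2 ≤ G.edgeFinset.card) :
    G.edgeFinset.card = n ^ 2 / 4 + (a - 1) ^ 2 ∧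
      ∃ B : Finset V, B.card * (Bᶜ).card = n ^ 2 / 4 ∧ IsBicliqueInClass G (a - 1) B := by
  refine exists_isBicliqueInClass_of_minDegree hV ha hℓ hD (by omega) hG hE ?_
  by_contra! hmin
  obtain ⟨v, hv⟩ := hmin
  obtain ⟨j, rfl⟩ : ∃ j, n = N + j + 1 := ⟨n - N - 1, by omega⟩
  have h1 : (G.induce {v}ᶜ).edgeFinset.card ≤
      (N + j) ^ 2 / 4 + max ((a - 1) ^ 2) (N ^ 2 - j) := by
    convert card_edgeFinset_le_of_free ha hℓ hD hN j ↥({v}ᶜ : Set V) (G.induce {v}ᶜ) (by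
      rw [Fintype.card_compl_set, hV]; simp)
      fun h => hG (h.trans (Embedding.induce _).isContained)
  have h2 := card_edgeFinset_induce_compl_add G v
  have h3 := sq_div_four_succ (N + j)
  -- Now `j ≥ N ^ 2`, so the smaller graph has excess at most `(a - 1) ^ 2` and a vertex of degree
  -- below `n / 2` would leave `G` with too few edges.
  rw [max_eq_left (by omega)] at h1
  omega

end Deletion

/-! ### Transfer to the standard Turán graph -/

section Iso

open SimpleGraph Finset
open scoped Classical

lemma card_filter_even (n : ℕ) :
    (univ.filter fun i : Fin n => i.val % 2 = 0).card = (n + 1) / 2 := by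
  rw [card_filter]
  induction n with
  | zero => simp
  | succ n ih =>
    rw [Fin.sum_univ_castSucc]
    simp only [Fin.val_castSucc, Fin.val_last]
    rw [ih]
    split_ifs <;> omega

lemma card_filter_odd (n : ℕ) :
    (univ.filter fun i : Fin n => i.val % 2 = 1).card = n / 2 := by
  rw [card_filter]
  induction n with
  | zero => simp
  | succ n ih =>
    rw [Fin.sum_univ_castSucc]
    simp only [Fin.val_castSucc, Fin.val_last]
    rw [ih]
    split_ifs <;> omega

lemma card_eq_half {x y n : ℕ} (h : x + y = n) (hxy : x * y = n ^ 2 / 4) :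
    x = n / 2 ∨ x = (n + 1) / 2 := by
  subst h
  by_contra! hcon
  have h1 : x * y + 1 ≤ (x + y) ^ 2 / 4 := by
    rw [Nat.le_div_iff_mul_le (by norm_num)]
    rcases le_total x y with hle | hle
    · obtain ⟨d, rfl⟩ := Nat.exists_eq_add_of_le hle
      have : 2 ≤ d := by omega
      nlinarith
    · obtain ⟨d, rfl⟩ := Nat.exists_eq_add_of_le hle
      have : 2 ≤ d := by omega
      nlinarith
  omega

/-- The product condition makes `B` as large as one of the residue classes mod `2`; a permutation
carrying `B` to that class is the isomorphism. -/
lemma IsBicliqueInClass.isTuranWithBiclique {n k : ℕ} {G : SimpleGraph (Fin n)}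
    {B : Finset (Fin n)} (h : IsBicliqueInClass G k B) (hB : B.card * (Bᶜ).card = n ^ 2 / 4) :
    IsTuranWithBiclique n k G := by
  obtain ⟨h1, h2, X, Y, hXB, hYB, hXY, hX, hY, h3⟩ := h
  have hcard : B.card + (Bᶜ).card = n := by rw [card_add_card_compl, Fintype.card_fin]
  obtain ⟨r, hr2, hr⟩ : ∃ r < 2, B.card = (univ.filter fun i : Fin n => i.val % 2 = r).card := by
    rcases card_eq_half hcard hB with h | h
    · exact ⟨1, by norm_num, by rw [card_filter_odd, h]⟩
    · exact ⟨0, by norm_num, by rw [card_filter_even, h]⟩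
  have hsub : Fintype.card {v // v ∈ B} = Fintype.card {i : Fin n // i.val % 2 = r} := by
    rw [Fintype.card_coe, hr, Fintype.card_subtype]
  let σ : Equiv.Perm (Fin n) := (Fintype.equivOfCardEq hsub).extendSubtype
  have hσ : ∀ v, v ∈ B ↔ (σ v).val % 2 = r := fun v =>
    ⟨fun hv => Equiv.extendSubtype_mem (Fintype.equivOfCardEq hsub) v hv, fun hv => by
      by_contra hv'
      exact Equiv.extendSubtype_not_mem (Fintype.equivOfCardEq hsub) v hv' hv⟩
  let eX := equivFinOfCardEq hX
  let eY := equivFinOfCardEq hY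
  let ψ : Fin k ⊕ Fin k → Fin n :=
    Sum.elim (fun i => σ (eX.symm i).1) (fun i => σ (eY.symm i).1)
  have hψ : Function.Injective ψ := by
    rintro (i | i) (j | j) hij <;> simp only [ψ, Sum.elim_inl, Sum.elim_inr] at hij <;>
      have hij := σ.injective hij
    · rw [eX.symm.injective (Subtype.ext hij)]
    · exact absurd (hij ▸ (eX.symm i).2) (fun hh => Finset.disjoint_left.1 hXY hh (eY.symm j).2)
    · exact absurd (hij ▸ (eX.symm j).2) (fun hh => Finset.disjoint_left.1 hXY hh (eY.symm i).2)
    · rw [eY.symm.injective (Subtype.ext hij)]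
  have hψl : ∀ u, (∃ i, ψ (.inl i) = σ u) ↔ u ∈ X := by
    intro u
    constructor
    · rintro ⟨i, hi⟩
      exact σ.injective hi ▸ (eX.symm i).2
    · intro hu
      exact ⟨eX ⟨u, hu⟩, by simp [ψ]⟩
  have hψr : ∀ u, (∃ i, ψ (.inr i) = σ u) ↔ u ∈ Y := by
    intro u
    constructor
    · rintro ⟨i, hi⟩
      exact σ.injective hi ▸ (eY.symm i).2
    · intro hu
      exact ⟨eY ⟨u, hu⟩, by simp [ψ]⟩
  have hmap : ∀ u w, ((completeBipartiteGraph (Fin k) (Fin k)).map (⟨ψ, hψ⟩ : _ ↪ _)).Adj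
      (σ u) (σ w) ↔ (u ∈ X ∧ w ∈ Y) ∨ (u ∈ Y ∧ w ∈ X) := by
    intro u w
    rw [map_adj, ← hψl, ← hψr, ← hψl, ← hψr]
    constructor
    · rintro ⟨i | i, j | j, hij, hi, hj⟩
      · simp at hij
      · exact Or.inl ⟨⟨i, hi⟩, ⟨j, hj⟩⟩
      · exact Or.inr ⟨⟨i, hi⟩, ⟨j, hj⟩⟩
      · simp at hij
    · rintro (⟨⟨i, hi⟩, j, hj⟩ | ⟨⟨i, hi⟩, j, hj⟩)
      · exact ⟨.inl i, .inr j, by simp, hi, hj⟩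
      · exact ⟨.inr i, .inl j, by simp, hi, hj⟩
  refine ⟨r, ⟨ψ, hψ⟩, ?_, ⟨⟨σ, ?_⟩⟩⟩
  · rintro (i | i)
    · exact (hσ _).1 (hXB (eX.symm i).2)
    · exact (hσ _).1 (hYB (eY.symm i).2)
  · intro u w
    rw [sup_adj, hmap, turanGraph_adj]
    have hu := hσ u
    have hw := hσ w
    by_cases huB : u ∈ B <;> by_cases hwB : w ∈ B
    · rw [h3 u huB w hwB, hu.1 huB, hw.1 hwB]
      simp
    · have := h1 u huB w hwB
      simp only [this, iff_true]
      left
      rw [hu.1 huB]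
      exact fun hh => hwB (hw.2 hh.symm)
    · have := (h1 w hwB u huB).symm
      simp only [this, iff_true]
      left
      rw [hw.1 hwB]
      exact fun hh => huB (hu.2 hh)
    · have h4 := h2 u huB w hwB
      simp only [h4, iff_false, not_or, not_and, not_not]
      refine ⟨?_, fun hh => absurd (hXB hh) huB, fun hh => absurd (hYB hh) huB⟩
      rw [hu] at huB
      rw [hw] at hwB
      omega

end Iso

/-! ### The extremal graphs are free and have the right size -/

section LowerBound

open SimpleGraph Finset
open scoped Classical

/-- `z` is a vertex of the cycle that replaces the edge `e`. -/
def InCycle {a : ℕ} {ℓ : (star a).edgeSet → ℕ} (e : (star a).edgeSet) :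
    Fin (a + 1) ⊕ (Σ e : (star a).edgeSet, Fin (ℓ e - 2)) → Prop
  | .inl w => w ∈ e.1
  | .inr x => x.1 = e

lemma InCycle.unique {a : ℕ} {ℓ : (star a).edgeSet → ℕ} {e e' : (star a).edgeSet}
    {z : Fin (a + 1) ⊕ (Σ e : (star a).edgeSet, Fin (ℓ e - 2))} (h : InCycle e z)
    (h' : InCycle e' z) (hz : z ≠ .inl 0) : e = e' := by
  rcases z with w | x
  · have hw : w ≠ 0 := fun hh => hz (hh ▸ rfl)
    have key : ∀ e : (star a).edgeSet, w ∈ e.1 → leafEdge w hw = e := by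
      rintro ⟨e, he⟩ ⟨y, rfl⟩
      have := (starGraph_adj.1 he).2.resolve_left hw
      subst this
      exact Subtype.ext Sym2.eq_swap
    exact (key e h).symm.trans (key e' h')
  · exact Eq.trans (Eq.symm h) h'

/-- An odd cycle of the ballooning has an edge whose ends get the same colour. -/
lemma exists_adj_of_two_coloring {a : ℕ} {ℓ : (star a).edgeSet → ℕ} {e : (star a).edgeSet}
    (h3 : 3 ≤ ℓ e) (hodd : Odd (ℓ e))
    (c : Fin (a + 1) ⊕ (Σ e : (star a).edgeSet, Fin (ℓ e - 2)) → ℕ) :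
    ∃ z z', InCycle e z ∧ InCycle e z' ∧ (ballooning (star a) ℓ).Adj z z' ∧
      c z % 2 = c z' % 2 := by
  by_contra! hcon
  have hout : s((Quot.out e.1).1, (Quot.out e.1).2) = e.1 := Quot.out_eq e.1
  have hu : InCycle (ℓ := ℓ) e (.inl (Quot.out e.1).1) :=
    show (Quot.out e.1).1 ∈ e.1 by
      have := Sym2.mem_mk_left (Quot.out e.1).1 (Quot.out e.1).2; rwa [hout] at this
  have hv : InCycle (ℓ := ℓ) e (.inl (Quot.out e.1).2) :=
    show (Quot.out e.1).2 ∈ e.1 by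
      have := Sym2.mem_mk_right (Quot.out e.1).1 (Quot.out e.1).2; rwa [hout] at this
  have hx : ∀ i, InCycle (ℓ := ℓ) e (.inr ⟨e, i⟩) := fun i => rfl
  have hadj : ∀ z z', z ≠ z' → ballooningRel (star a) ℓ z z' → (ballooning (star a) ℓ).Adj z z' :=
    fun z z' hne h => (fromRel_adj _ _ _).2 ⟨hne, Or.inl h⟩
  have huv := hcon _ _ hu hv (hadj _ _ (by simpa using (mem_star_edge e).1) (by
    have := e.2
    rw [← hout] at this
    exact this))
  -- If no edge of the cycle is monochromatic, parities alternate along the new vertices from the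
  -- first end on, which fails at the second end because the cycle is odd.
  have hnew : ∀ i (hi : i < ℓ e - 2), c (.inr ⟨e, ⟨i, hi⟩⟩) % 2 =
      (c (.inl (Quot.out e.1).1) + i + 1) % 2 := by
    intro i
    induction i with
    | zero =>
      intro hi
      have := hcon _ _ hu (hx ⟨0, hi⟩) (hadj _ _ (by simp) (Or.inl ⟨rfl, rfl⟩))
      omega
    | succ i ih =>
      intro hi
      have h1 := ih (by omega)
      have := hcon _ _ (hx ⟨i, by omega⟩) (hx ⟨i + 1, hi⟩) (hadj _ _ (by simp) ⟨rfl, rfl⟩)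
      omega
  have h1 := hnew (ℓ e - 3) (by omega)
  have h2 := hcon _ _ hv (hx ⟨ℓ e - 3, by omega⟩)
    (hadj _ _ (by simp) (Or.inr ⟨rfl, show ℓ e - 3 + 3 = ℓ e by omega⟩))
  obtain ⟨q, hq⟩ := hodd
  omega

/-- Each cycle contains an edge within a residue class, so a biclique vertex from either side. The
centre lies on at most one side; on a side without it, vertices chosen from different cycles are
distinct. -/
lemma free_turanGraph_sup_biclique {a n k : ℕ} (hk : k < a) {ℓ : (star a).edgeSet → ℕ}
    (hℓ : ∀ e, 3 ≤ ℓ e ∧ Odd (ℓ e)) (φ : (Fin k ⊕ Fin k) ↪ Fin n) :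
    (ballooning (star a) ℓ).Free
      (turanGraph n 2 ⊔ (completeBipartiteGraph (Fin k) (Fin k)).map φ) := by
  rintro ⟨f⟩
  have key : ∀ e : (star a).edgeSet, ∃ x y i j, InCycle e x ∧ InCycle e y ∧
      f x = φ (.inl i) ∧ f y = φ (.inr j) := by
    intro e
    obtain ⟨z, z', hz, hz', hadj, hc⟩ := exists_adj_of_two_coloring (hℓ e).1 (hℓ e).2
      fun z => (f z).val
    have h1 := f.toHom.map_adj hadj
    rw [sup_adj, turanGraph_adj] at h1
    have h2 := h1.resolve_left (fun hne => hne hc)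
    rw [map_adj] at h2
    obtain ⟨i | i, j | j, hij, hi, hj⟩ := h2
    · simp at hij
    · exact ⟨z, z', i, j, hz, hz', hi.symm, hj.symm⟩
    · exact ⟨z', z, j, i, hz', hz, hj.symm, hi.symm⟩
    · simp at hij
  choose x y i j hx hy hi hj using key
  have hcard := card_edgeSet_star a
  have hle : Fintype.card (star a).edgeSet ≤ Fintype.card (Fin k) := by
    by_cases h0 : ∃ i₀, f (.inl 0) = φ (.inl i₀)
    · obtain ⟨i₀, h0⟩ := h0
      refine Fintype.card_le_of_injective j fun e e' h => ?_
      have h1 : y e = y e' := f.injective ((hj e).trans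
        ((congrArg (fun j => φ (.inr j)) h).trans (hj e').symm))
      refine (hy e).unique (h1 ▸ hy e') fun h2 => ?_
      have := hj e
      rw [h2, h0] at this
      simpa using φ.injective this
    · refine Fintype.card_le_of_injective i fun e e' h => ?_
      have h1 : x e = x e' := f.injective ((hi e).trans
        ((congrArg (fun i => φ (.inl i)) h).trans (hi e').symm))
      refine (hx e).unique (h1 ▸ hx e') fun h2 => h0 ⟨i e, ?_⟩
      rw [← h2]
      exact hi e
  rw [hcard, Fintype.card_fin] at hle
  omega

lemma card_edgeFinset_turanGraph_two (n : ℕ) : (turanGraph n 2).edgeFinset.card = n ^ 2 / 4 := by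
  have := card_edgeFinset_turanGraph (n := n) (r := 2)
  rcases Nat.even_or_odd' n with ⟨m, rfl | rfl⟩
  · have h1 : 2 * m % 2 = 0 := by omega
    rw [h1] at this
    convert this using 1
    simp
  · have h1 : (2 * m + 1) % 2 = 1 := by omega
    rw [h1] at this
    convert this using 1
    have h1 : (2 * m + 1) ^ 2 = 4 * (m ^ 2 + m) + 1 := by ring
    rw [h1]
    simp
    omega

lemma card_edgeFinset_turanGraph_sup_biclique {n k r : ℕ} (φ : (Fin k ⊕ Fin k) ↪ Fin n)
    (hφ : ∀ x, (φ x).val % 2 = r) :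
    (turanGraph n 2 ⊔ (completeBipartiteGraph (Fin k) (Fin k)).map φ).edgeFinset.card =
      n ^ 2 / 4 + k ^ 2 := by
  rw [edgeFinset_sup, card_union_of_disjoint, card_edgeFinset_map]
  · congr 1
    · convert card_edgeFinset_turanGraph_two n
    · have := encard_edgeSet_completeBipartiteGraph (W₁ := Fin k) (W₂ := Fin k)
      rw [← coe_edgeFinset, Set.encard_coe_eq_coe_finsetCard] at this
      simp only [ENat.card_eq_coe_fintype_card, Fintype.card_fin] at this
      rw [sq]
      exact_mod_cast this
  · rw [Finset.disjoint_left]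
    intro e h1 h2
    induction e using Sym2.ind with
    | _ u w =>
      rw [mem_edgeFinset, mem_edgeSet] at h1 h2
      rw [turanGraph_adj] at h1
      obtain ⟨x, y, -, rfl, rfl⟩ := (map_adj _ _ _ _).1 h2
      exact h1 ((hφ x).trans (hφ y).symm)

lemma exists_biclique_embedding {n k : ℕ} (h : 4 * k ≤ n) :
    ∃ φ : (Fin k ⊕ Fin k) ↪ Fin n, ∀ x, (φ x).val % 2 = 0 := by
  refine ⟨⟨Sum.elim (fun i => ⟨2 * i.val, by omega⟩) fun i => ⟨2 * k + 2 * i.val, by omega⟩, ?_⟩, ?_⟩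
  · rintro (i | i) (j | j) hij <;> simp only [Sum.elim_inl, Sum.elim_inr, Fin.mk.injEq] at hij
    · rw [Fin.ext (by omega : i.val = j.val)]
    · omega
    · omega
    · rw [Fin.ext (by omega : i.val = j.val)]
  · rintro (i | i)
    · change (2 * i.val) % 2 = 0
      omega
    · change (2 * k + 2 * i.val) % 2 = 0
      omega

end LowerBound

end OddBallooning

/-! ### The extremal number and the extremal graphs -/

theorem mainTheorem4 (a t : ℕ) (ha : 2 ≤ a) (ht : 5 ≤ t) (htodd : Odd t)
    (ℓ : (OddBallooning.star a).edgeSet → ℕ) (hℓ : ∀ e, Odd (ℓ e) ∧ t ≤ ℓ e) :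
    ∃ N : ℕ, ∀ n : ℕ, N ≤ n →
      SimpleGraph.extremalNumber n (OddBallooning.ballooning (OddBallooning.star a) ℓ) =
          (SimpleGraph.turanGraph n 2).edgeFinset.card + (a - 1) ^ 2 ∧
      ∀ (G : SimpleGraph (Fin n)) [DecidableRel G.Adj],
        G.IsExtremal (OddBallooning.ballooning (OddBallooning.star a) ℓ).Free ↔
          OddBallooning.IsTuranWithBiclique n (a - 1) G := by
  classical
  have hℓ5 : ∀ e, 5 ≤ ℓ e ∧ Odd (ℓ e) := fun e => ⟨ht.trans (hℓ e).2, (hℓ e).1⟩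
  have hℓ3 : ∀ e, 3 ≤ ℓ e ∧ Odd (ℓ e) := fun e => ⟨by have := (hℓ5 e).1; omega, (hℓ e).1⟩
  obtain ⟨D, hD⟩ : ∃ D, ∀ e, ℓ e ≤ D :=
    ⟨∑ e, ℓ e, fun e => Finset.single_le_sum (fun _ _ => Nat.zero_le _) (Finset.mem_univ e)⟩
  obtain ⟨N, hN⟩ : ∃ N, N = 4096 * (2 * (a * D + D) + 1) + 8 * (a * (D + 2) + D + 5) := ⟨_, rfl⟩
  -- The deletion argument needs `N + N ^ 2 < n`, and `4 * (a - 1) ≤ n` makes room for the biclique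
  -- in one class.
  refine ⟨N + N ^ 2 + 1 + 4 * (a - 1), fun n hn => ?_⟩
  have hupper : ∀ (G : SimpleGraph (Fin n)) [DecidableRel G.Adj],
      (OddBallooning.ballooning (OddBallooning.star a) ℓ).Free G →
      n ^ 2 / 4 + (a - 1) ^ 2 ≤ G.edgeFinset.card →
      G.edgeFinset.card = n ^ 2 / 4 + (a - 1) ^ 2 ∧
        OddBallooning.IsTuranWithBiclique n (a - 1) G := by
    intro G _ hG hE
    obtain ⟨h1, B, h2, h3⟩ := OddBallooning.exists_isBicliqueInClass_of_card_le ha hℓ5 hD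
      hN.ge (G := G) (Fintype.card_fin n) (by omega) hG (by convert hE)
    refine ⟨?_, h3.isTuranWithBiclique (by convert h2)⟩
    convert h1
  have hlower : ∀ (G : SimpleGraph (Fin n)) [DecidableRel G.Adj],
      OddBallooning.IsTuranWithBiclique n (a - 1) G →
      (OddBallooning.ballooning (OddBallooning.star a) ℓ).Free G ∧
        G.edgeFinset.card = n ^ 2 / 4 + (a - 1) ^ 2 := by
    rintro G _ ⟨r, φ, hφ, ⟨g⟩⟩
    refine ⟨(SimpleGraph.free_congr_right g).2
      (OddBallooning.free_turanGraph_sup_biclique (by omega) hℓ3 φ), ?_⟩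
    rw [g.card_edgeFinset_eq]
    convert OddBallooning.card_edgeFinset_turanGraph_sup_biclique φ hφ
  have hex : SimpleGraph.extremalNumber n (OddBallooning.ballooning (OddBallooning.star a) ℓ) =
      n ^ 2 / 4 + (a - 1) ^ 2 := by
    apply le_antisymm
    · have h1 := (SimpleGraph.extremalNumber_le_iff (V := Fin n)
        (OddBallooning.ballooning (OddBallooning.star a) ℓ) (n ^ 2 / 4 + (a - 1) ^ 2)).2 (by
          intro G _ hG
          by_contra! hcon
          have := (hupper G hG hcon.le).1
          omega)
      rwa [Fintype.card_fin] at h1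
    · obtain ⟨φ, hφ⟩ := OddBallooning.exists_biclique_embedding (n := n) (k := a - 1) (by omega)
      obtain ⟨h1, h2⟩ := hlower _ ⟨0, φ, hφ, ⟨SimpleGraph.Iso.refl⟩⟩
      have := SimpleGraph.card_edgeFinset_le_extremalNumber h1
      rwa [h2, Fintype.card_fin] at this
  refine ⟨?_, fun G _ => ?_⟩
  · rw [hex, ← OddBallooning.card_edgeFinset_turanGraph_two]
  · rw [SimpleGraph.isExtremal_free_iff, Fintype.card_fin, hex]
    exact ⟨fun h => (hupper G h.1 h.2.ge).2, hlower G⟩
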